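/- Let $n,m\ge 0$ be integers, and let $E$ and $A'$ be finite-dimensional quantum systems. Let $\rho_{AE}=\sum_{a\in\{0,1\}^n}|a\rangle\langle a|_A\otimes\rho_E^{a}$ be a nonzero sub-normalized classical-quantum state ($\rho_E^a\ge 0$, $\sum_a\mathrm{Tr}\,\rho_E^a\le 1$), where $A$ is an $n$-qubit system, and let $|\Psi\rangle_{AEA'}$ be any purification of it, $\mathrm{Tr}_{A'}|\Psi\rangle\langle\Psi|=\rho_{AE}$. Let $G$ be a random hash function: a finite family of linear surjective maps $g:\{0,1\}^n\to\{0,1\}^m$ over $\mathbb F_2$ with probabilities $\Pr(G=g)$. Assume that $G$ is universal$_2$: $\Pr(G(a)=G(a'))\le 2^{-m}$ for all $a\ne a'$. *Secrecy measure.* Put $\rho_E=\sum_a\rho_E^a$ and $$\rho^{\rm fin}_{KEG}=\sum_g\Pr(G=g)\sum_{k\in\{0,1\}^m}|k\rangle\langle k|_K\otimes\Big(\sum_{a\in g^{-1}(k)}\rho_E^a\Big)\otimes|g\rangle\langle g|_G,$$ $$\rho^{\rm ideal}_{KEG}=\sum_g\Pr(G=g)\,2^{-m}\sum_k|k\rangle\langle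 k|_K\otimes\rho_E\otimes|g\rangle\langle g|_G,$$ and $d_1(\rho^{\rm fin}_{KEG})=\|\rho^{\rm fin}_{KEG}-\rho^{\rm ideal}_{KEG}\|_1$, where $\|M\|_1=\mathrm{Tr}\sqrt{M^\dagger M}$. *Min-entropy.* $H_{\min}(\rho_{AE}|E)$ is the maximum real $\lambda$ such that $2^{-\lambda}\,\mathbb I_A\otimes\sigma_E\ge\rho_{AE}$ for some normalized state $\sigma_E$. *Phase error correction (PEC).* For each $g$ fix a check matrix $h\in\mathbb F_2^{(n-m)\times n}$ of the code $(\ker g)^\perp$, with rows $h_1,\dots,h_{n-m}$. The PEC for $g$ (i) measures the commuting operators $X^{h_1},\dots,X^{h_{n-m}}$ on $A$, with outcome eigenvalues $(-1)^{s_j}$, $s\in\{0,1\}^{n-m}$; (ii) measures $A'$ with operators $\{E^{g,s,e}\}_{e\in\{0,1\}^n}$, $\sum_e E^{g,s,e\,\dagger}E^{g,s,e}=\mathbb I_{A'}$, with outcome $e$; (iii) applies $Z^e$ to $A$. Let $\rho^{{\rm pec},g}$ be its output on $|\Psi\rangle\langle\Psi|$, and let $$P^{\rm ph}_A(\rho^{{\rm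 pec},g})=\mathrm{Tr}\,\rho^{{\rm pec},g}_A-\langle\widetilde 0|\rho_A^{{\rm pec},g}|\widetilde 0\rangle,\qquad |\widetilde 0\rangle=2^{-n/2}\sum_z|z\rangle,$$ be its failure probability (equal to $1-\langle\widetilde 0|\rho_A^{{\rm pec},g}|\widetilde 0\rangle$ in the normalized case). Then, for every choice of the ancilla measurements $\{E^{g,s,e}\}$, $$d_1(\rho^{\rm fin}_{KEG})\le 2\sqrt2\,\sqrt{\sum_g\Pr(G=g)\,P^{\rm ph}_A(\rho^{{\rm pec},g})},$$ and there is a choice of the ancilla measurements for which moreover $$2\sqrt2\,\sqrt{\sum_g\Pr(G=g)\,P^{\rm ph}_A(\rho^{{\rm pec},g})}\le 2\sqrt2\cdot 2^{\frac12[m-H_{\min}(\rho_{AE}|E)]}=2^{\frac12[m-H_{\min}(\rho_{AE}|E)+3]}.$$ -/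

import Mathlib

open scoped Matrix Kronecker MatrixOrder ComplexOrder

noncomputable section

namespace PhaseEC

/-- Bit strings of length `n`, with arithmetic modulo 2. -/
abbrev Bits (n : ℕ) : Type := Fin n → ZMod 2

/-- `(-1)^b`. -/
def sgn (b : ZMod 2) : ℂ := (-1) ^ b.val

/-- The Pauli operator `Z^z = ⊗ᵢ Z^{zᵢ}`: `Z^z |a⟩ = (-1)^{z·a} |a⟩`. -/
def pauliZ {n : ℕ} (z : Bits n) : Matrix (Bits n) (Bits n) ℂ :=
  Matrix.diagonal fun a => sgn (z ⬝ᵥ a)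

/-- The Pauli operator `X^x = ⊗ᵢ X^{xᵢ}`: `X^x |a⟩ = |a + x⟩`. -/
def pauliX {n : ℕ} (x : Bits n) : Matrix (Bits n) (Bits n) ℂ :=
  Matrix.of fun b a => if b = a + x then 1 else 0

/-- The phase-basis vector `2^{-n/2} ∑_z (-1)^{x·z} |z⟩`. -/
def phaseKet {n : ℕ} (x : Bits n) : Bits n → ℂ :=
  fun z => ((Real.sqrt (2 ^ n))⁻¹ : ℝ) * sgn (x ⬝ᵥ z)

/-- `|i⟩⟨i|`. -/
def proj {ι : Type*} [DecidableEq ι] (i : ι) : Matrix ι ι ℂ := Matrix.single i i 1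

/-- `|v⟩⟨v|`. -/
def ketBra {ι : Type*} (v : ι → ℂ) : Matrix ι ι ℂ := Matrix.vecMulVec v (star v)

/-- The partial trace over the second tensor factor. -/
def traceRight {ι κ : Type*} [Fintype κ] (M : Matrix (ι × κ) (ι × κ) ℂ) : Matrix ι ι ℂ :=
  Matrix.of fun i j => ∑ k, M (i, k) (j, k)

/-- The `L₁` norm `Tr |M| = Tr √(M† M)`. -/
def traceNorm {ι : Type*} [Fintype ι] [DecidableEq ι] (M : Matrix ι ι ℂ) : ℝ :=
  (CFC.sqrt (Mᴴ * M)).trace.re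

section States

variable {n m : ℕ} {E A' G : Type*} [Fintype E] [DecidableEq E] [Fintype A'] [DecidableEq A']
  [Fintype G] [DecidableEq G]

/-- `ρ^a`, `a ∈ {0,1}^n`, are the blocks of a sub-normalized cq state:
each is positive semi-definite and their traces sum to at most `1`. -/
def IsSubnormalizedCQ (ρ : Bits n → Matrix E E ℂ) : Prop :=
  (∀ a, (ρ a).PosSemidef) ∧ (∑ a, (ρ a).trace).re ≤ 1

/-- The cq state `ρ_AE = ∑_a |a⟩⟨a| ⊗ ρ^a`. -/
def cqState (ρ : Bits n → Matrix E E ℂ) : Matrix (Bits n × E) (Bits n × E) ℂ :=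
  ∑ a, proj a ⊗ₖ ρ a

/-- The vector `Ψ` of `A ⊗ E ⊗ A'` is a purification of `ρ_AE`. -/
def IsPurification (Ψ : (Bits n × E) × A' → ℂ) (ρ : Matrix (Bits n × E) (Bits n × E) ℂ) : Prop :=
  traceRight (ketBra Ψ) = ρ

/-- The real numbers `r` with `2^{-r} 1_A ⊗ σ_E ≥ ρ_AE` for some normalized state `σ_E`. -/
def minEntropySet {A : Type*} [Fintype A] [DecidableEq A]
    (ρ : Matrix (A × E) (A × E) ℂ) : Set ℝ :=
  {r | ∃ σ : Matrix E E ℂ, σ.PosSemidef ∧ σ.trace = 1 ∧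
    ρ ≤ (((2 : ℝ) ^ (-r) : ℝ) : ℂ) • ((1 : Matrix A A ℂ) ⊗ₖ σ)}

/-- The conditional min-entropy `H_min(ρ_AE | E)` of a nonzero sub-normalized state. For such a
state the set is nonempty, bounded above and closed, so that the supremum is its maximum. -/
def condMinEntropy {A : Type*} [Fintype A] [DecidableEq A]
    (ρ : Matrix (A × E) (A × E) ℂ) : ℝ :=
  sSup (minEntropySet ρ)

/-- The key-Eve state `∑_k |k⟩⟨k| ⊗ ∑_{a ∈ g⁻¹(k)} ρ^a` after hashing with `g`. -/
def finalStateKE (ρ : Bits n → Matrix E E ℂ) (g : Bits n → Bits m) :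
    Matrix (Bits m × E) (Bits m × E) ℂ :=
  ∑ k, proj k ⊗ₖ (∑ a with g a = k, ρ a)

/-- The ideal key-Eve state `2^{-m} ∑_k |k⟩⟨k| ⊗ ρ_E`, with `ρ_E = ∑_a ρ^a`. -/
def idealStateKE (m : ℕ) (ρ : Bits n → Matrix E E ℂ) :
    Matrix (Bits m × E) (Bits m × E) ℂ :=
  ((2 : ℂ) ^ m)⁻¹ • ∑ k, proj k ⊗ₖ (∑ a, ρ a)

/-- `∑_g Pr(G = g) τ^g ⊗ |g⟩⟨g|`. -/
def publicMixture {κ : Type*} (p : G → ℝ) (τ : G → Matrix κ κ ℂ) :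
    Matrix (κ × G) (κ × G) ℂ :=
  ∑ g, ((p g : ℝ) : ℂ) • (τ g ⊗ₖ proj g)

/-- The secrecy measure `d₁(ρ_KEG) = ‖ρ_KEG^fin - ρ_KEG^ideal‖₁`. -/
def secrecyDist (p : G → ℝ) (g : G → Bits n → Bits m) (ρ : Bits n → Matrix E E ℂ) : ℝ :=
  traceNorm (publicMixture p (fun i => finalStateKE ρ (g i)) -
    publicMixture p (fun _ => idealStateKE m ρ))

/-- Probability weights on the finite index set of a hash family. -/
def IsProbability (p : G → ℝ) : Prop := (∀ i, 0 ≤ p i) ∧ ∑ i, p i = 1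

/-- The universal₂ property of a random hash function. -/
def IsUniversal2 (p : G → ℝ) (g : G → Bits n → Bits m) : Prop :=
  ∀ a a', a ≠ a' → ∑ i with g i a = g i a', p i ≤ ((2 : ℝ) ^ m)⁻¹

/-- `h` is a check matrix of the classical code `C^g = (ker g)^⊥`. -/
def IsCheckMatrix (g : Bits n →ₗ[ZMod 2] Bits m) (h : Matrix (Fin (n - m)) (Fin n) (ZMod 2)) :
    Prop :=
  ∀ x : Bits n, h *ᵥ x = 0 ↔ ∀ a, g a = 0 → x ⬝ᵥ a = 0

/-- The projection for the outcome `s` of measuring the commuting operators `X^{h_j}`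
(`h_j` the `j`-th row of `h`), i.e. for the eigenvalues `(-1)^{s_j}`. -/
def syndromeProj {r : ℕ} (h : Matrix (Fin r) (Fin n) (ZMod 2)) (s : Bits r) :
    Matrix (Bits n) (Bits n) ℂ :=
  (List.ofFn fun j => (2 : ℂ)⁻¹ • (1 + sgn (s j) • pauliX (h j))).prod

/-- An ancilla measurement for each syndrome `s`: operators `M s e` on `A'` with
`∑_e (M s e)† (M s e) = 1`. -/
def IsAncillaMeasurement {r : ℕ} (M : Bits r → Bits n → Matrix A' A' ℂ) : Prop :=
  ∀ s, ∑ e, (M s e)ᴴ * M s e = 1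

/-- The operator on `A ⊗ E ⊗ A'` for syndrome `s` and estimated error `e`: syndrome projection,
ancilla measurement, phase flip `Z^e`. -/
def pecKraus (E : Type*) [DecidableEq E] {r : ℕ} (h : Matrix (Fin r) (Fin n) (ZMod 2))
    (M : Bits r → Bits n → Matrix A' A' ℂ) (s : Bits r) (e : Bits n) :
    Matrix ((Bits n × E) × A') ((Bits n × E) × A') ℂ :=
  ((pauliZ e * syndromeProj h s) ⊗ₖ (1 : Matrix E E ℂ)) ⊗ₖ M s e

/-- The state after phase error correction of `|Ψ⟩⟨Ψ|`. -/
def pecState {r : ℕ} (h : Matrix (Fin r) (Fin n) (ZMod 2))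
    (M : Bits r → Bits n → Matrix A' A' ℂ) (Ψ : (Bits n × E) × A' → ℂ) :
    Matrix ((Bits n × E) × A') ((Bits n × E) × A') ℂ :=
  ∑ s, ∑ e, pecKraus E h M s e * ketBra Ψ * (pecKraus E h M s e)ᴴ

/-- The phase error probability in `A`: the weight `Tr τ_A - ⟨0~|τ_A|0~⟩` of all phases other
than `0~` in the reduced state `τ_A`. It is `1 - ⟨0~|τ_A|0~⟩` when `τ` is normalized. -/
def phaseErrorProb (τ : Matrix ((Bits n × E) × A') ((Bits n × E) × A') ℂ) : ℝ :=
  ((traceRight (traceRight τ)).trace -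
    star (phaseKet (0 : Bits n)) ⬝ᵥ (traceRight (traceRight τ) *ᵥ phaseKet 0)).re

/-- The average failure probability of phase error correction over the random hash function. -/
def avgFailureProb {r : ℕ} (p : G → ℝ) (h : G → Matrix (Fin r) (Fin n) (ZMod 2))
    (M : G → Bits r → Bits n → Matrix A' A' ℂ) (Ψ : (Bits n × E) × A' → ℂ) : ℝ :=
  ∑ i, p i * phaseErrorProb (pecState (h i) (M i) Ψ)

end States

end PhaseEC

end

/-! The two inequalities are independent.

Secrecy bound. The operators `X^{h_j}` preserve the hash value `g a` and `Z^e` is diagonal, so phase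
error correction leaves the joint state of key and `E` unchanged (`sum_pecBlock_gram`). The
corrected state therefore gives a purification of the final state; putting `A` into `|0~⟩` and
storing its old content, in the phase basis, in a spare register gives a purification of the ideal
state. Their overlap is the weight of the phase `0~`, that is, `t - P` with `t = Tr ρ_E` and `P` the
failure probability. The fidelity bound `traceNorm_gram_sub_gram_le` gives the distance `2√(t² - (t
- P)²) ≤ 2√(2P)`, as `t ≤ 1`. Direct sums weighted by `√p_i` carry this over to a random `g`.

Failure bound. Let `S = ρ_E^{1/4}`, let `D` be its pseudo-inverse, and let `ρ_k` be the block of `E`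
for the key `k`. The ancilla measurement resembles a pretty good measurement: its operators are
Fourier sums of `f(a)† J(g a)`, with `J k` chosen so that `J k (J k)†` is a generalized inverse of
`ρ_k`. On each syndrome coset the effects sum to a projection. Linearizing the success probability
and applying `3s²v² ≤ 2s³v + v⁴` (`three_trace_sq_le`) bounds the failure by `2^m ∑_k Tr (D ρ_k D)²
- t`, a collision quantity as in the leftover hash lemma. Averaging over a universal₂ family, pairs
`a ≠ b` contribute at most `t`, and the diagonal at most `2^{m-r}` whenever `ρ_AE ≤ 2^{-r} 1 ⊗ σ`
(`sum_collision_le`). -/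

open scoped Matrix Kronecker MatrixOrder ComplexOrder

noncomputable section

namespace PhaseEC

/-! ### Trace inequalities and functional calculus for matrices. -/

section MatrixAnalysis

variable {ι κ : Type*} [Fintype ι] [Fintype κ]

lemma re_trace_mul_conjTranspose_nonneg (X : Matrix ι κ ℂ) : 0 ≤ (X * Xᴴ).trace.re :=
  (Complex.le_def.1 (Matrix.posSemidef_self_mul_conjTranspose X).trace_nonneg).1

lemma re_trace_conjTranspose (X : Matrix ι ι ℂ) : Xᴴ.trace.re = X.trace.re := by
  simp [Matrix.trace_conjTranspose]

lemma re_trace_mul_nonneg [DecidableEq ι] {A B : Matrix ι ι ℂ} (hA : A.PosSemidef)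
    (hB : B.PosSemidef) : 0 ≤ (A * B).trace.re := by
  obtain ⟨C, rfl⟩ := CStarAlgebra.nonneg_iff_eq_star_mul_self.1 hA.nonneg
  obtain ⟨D, rfl⟩ := CStarAlgebra.nonneg_iff_eq_star_mul_self.1 hB.nonneg
  have : (Cᴴ * C * (Dᴴ * D)).trace = ((C * Dᴴ) * (C * Dᴴ)ᴴ).trace := by
    rw [Matrix.conjTranspose_mul, Matrix.conjTranspose_conjTranspose, ← Matrix.mul_assoc,
      Matrix.trace_mul_comm, Matrix.trace_mul_comm]
    simp only [Matrix.mul_assoc]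
    rw [Matrix.trace_mul_comm]
    simp only [Matrix.mul_assoc]
  rw [Matrix.star_eq_conjTranspose, Matrix.star_eq_conjTranspose, this]
  exact re_trace_mul_conjTranspose_nonneg _

lemma re_trace_mul_conjTranspose_comm (X Y : Matrix ι κ ℂ) :
    (Y * Xᴴ).trace.re = (X * Yᴴ).trace.re := by
  rw [← re_trace_conjTranspose]; simp

lemma re_trace_gram_add (X Y : Matrix ι κ ℂ) :
    ((X + Y) * (X + Y)ᴴ).trace.re
      = (X * Xᴴ).trace.re + 2 * (X * Yᴴ).trace.re + (Y * Yᴴ).trace.re := by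
  have := re_trace_mul_conjTranspose_comm X Y
  simp only [Matrix.conjTranspose_add, Matrix.add_mul, Matrix.mul_add, Matrix.trace_add,
    Complex.add_re]
  linarith

lemma re_trace_gram_sub (X Y : Matrix ι κ ℂ) :
    ((X - Y) * (X - Y)ᴴ).trace.re
      = (X * Xᴴ).trace.re - 2 * (X * Yᴴ).trace.re + (Y * Yᴴ).trace.re := by
  have := re_trace_mul_conjTranspose_comm X Y
  simp only [Matrix.conjTranspose_sub, Matrix.sub_mul, Matrix.mul_sub, Matrix.trace_sub,
    Complex.sub_re]
  linarith

/-- The Cauchy-Schwarz inequality for the Hilbert-Schmidt inner product. -/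
lemma re_trace_mul_conjTranspose_le (X Y : Matrix ι κ ℂ) :
    (X * Yᴴ).trace.re ≤ √((X * Xᴴ).trace.re * (Y * Yᴴ).trace.re) := by
  apply Real.le_sqrt_of_sq_le
  have h : ∀ t : ℝ, 0 ≤ (Y * Yᴴ).trace.re * (t * t) + (2 * (X * Yᴴ).trace.re) * t
      + (X * Xᴴ).trace.re := by
    intro t
    have := re_trace_mul_conjTranspose_nonneg (X + (t : ℂ) • Y)
    rw [re_trace_gram_add] at this
    simp at this
    linarith
  have := discrim_le_zero h
  unfold discrim at this
  linarith

variable [DecidableEq ι]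

lemma cfc_mul_cfc (A : Matrix ι ι ℂ) (f f' : ℝ → ℝ) :
    cfc f A * cfc f' A = cfc (fun x => f x * f' x) A :=
  (cfc_mul f f' A (A.finite_real_spectrum.continuousOn f)
    (A.finite_real_spectrum.continuousOn f')).symm

lemma isHermitian_cfc (A : Matrix ι ι ℂ) (f : ℝ → ℝ) : (cfc f A).IsHermitian :=
  cfc_predicate f A

/-- A Hermitian matrix has a unitary Hermitian sign. -/
lemma exists_sign_traceNorm {D : Matrix ι ι ℂ} (hD : D.IsHermitian) :
    ∃ S : Matrix ι ι ℂ, S.IsHermitian ∧ S * S = 1 ∧ traceNorm D = (S * D).trace.re := by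
  have hs : IsSelfAdjoint D := hD
  -- The sign takes the value `1` at `0`, so that its square is `1` even when `D` is singular.
  refine ⟨cfc (fun x : ℝ => if 0 ≤ x then 1 else -1) D, isHermitian_cfc _ _, ?_, ?_⟩
  · rw [cfc_mul_cfc, ← cfc_one ℝ D]
    refine cfc_congr fun x _ => ?_
    by_cases hx : 0 ≤ x <;> simp [hx]
  · have h1 : cfc (fun x : ℝ => if 0 ≤ x then 1 else -1) D * D = cfc (fun x : ℝ => |x|) D := by
      nth_rewrite 2 [← cfc_id' ℝ D]
      rw [cfc_mul_cfc]
      refine cfc_congr fun x _ => ?_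
      by_cases hx : 0 ≤ x
      · simp [hx, abs_of_nonneg]
      · simp [hx, abs_of_neg (not_le.1 hx)]
    have h2 : CFC.sqrt (Dᴴ * D) = cfc (fun x : ℝ => |x|) D := by
      refine CFC.sqrt_unique ?_ (cfc_nonneg fun x _ => abs_nonneg x)
      rw [cfc_mul_cfc, hD.eq]
      conv_rhs => rw [← cfc_id' ℝ D, cfc_mul_cfc]
      exact cfc_congr fun x _ => abs_mul_abs_self x
    rw [traceNorm, h1, h2]

/-- A pure-state fidelity bound on the trace distance. -/
lemma traceNorm_gram_sub_gram_le (V W : Matrix ι κ ℂ) (t : ℝ) (hV : (V * Vᴴ).trace.re = t)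
    (hW : (W * Wᴴ).trace.re = t) :
    traceNorm (V * Vᴴ - W * Wᴴ) ≤ 2 * √(t ^ 2 - (V * Wᴴ).trace.re ^ 2) := by
  have hD : (V * Vᴴ - W * Wᴴ).IsHermitian := by
    simp [Matrix.IsHermitian]
  obtain ⟨S, hS, hSS, hn⟩ := exists_sign_traceNorm hD
  -- The cross terms `S V W†` and `S W V†` have conjugate traces, so they cancel in the real part.
  -- Cauchy-Schwarz then separates `V - W` from `V + W`.
  have h1 : (S * (V * Vᴴ - W * Wᴴ)).trace.re
      = ((S * (V - W)) * (V + W)ᴴ).trace.re := by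
    have h2 : (S * (V * Wᴴ)).trace.re = (S * (W * Vᴴ)).trace.re := by
      rw [← re_trace_conjTranspose]
      simp only [Matrix.conjTranspose_mul, Matrix.conjTranspose_conjTranspose, hS.eq]
      rw [Matrix.trace_mul_comm]
    simp only [Matrix.conjTranspose_add, Matrix.mul_assoc, Matrix.sub_mul, Matrix.mul_add,
      Matrix.mul_sub, Matrix.trace_add, Matrix.trace_sub, Complex.add_re, Complex.sub_re]
    linarith
  have h3 : ((S * (V - W)) * (S * (V - W))ᴴ).trace.re = ((V - W) * (V - W)ᴴ).trace.re := by
    rw [Matrix.conjTranspose_mul, hS.eq, Matrix.trace_mul_comm]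
    simp only [Matrix.mul_assoc]
    rw [← Matrix.mul_assoc S S, hSS, Matrix.one_mul, Matrix.trace_mul_comm]
  rw [hn, h1]
  refine (re_trace_mul_conjTranspose_le _ _).trans (le_of_eq ?_)
  rw [h3, re_trace_gram_add, re_trace_gram_sub, hV, hW]
  rw [show (t - 2 * (V * Wᴴ).trace.re + t) * (t + 2 * (V * Wᴴ).trace.re + t)
      = 2 ^ 2 * (t ^ 2 - (V * Wᴴ).trace.re ^ 2) by ring, Real.sqrt_mul (by norm_num),
    Real.sqrt_sq (by norm_num)]

/-- The square root of a positive semi-definite matrix and its Moore-Penrose inverse. -/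
lemma exists_sqrt_pinv {A : Matrix ι ι ℂ} (hA : A.PosSemidef) :
    ∃ V W : Matrix ι ι ℂ, V.PosSemidef ∧ W.IsHermitian ∧ V * V = A ∧ V * W = W * V ∧
      V * W * V = V ∧ W * V * W = W := by
  have hA0 : 0 ≤ A := Matrix.nonneg_iff_posSemidef.2 hA
  have hs : IsSelfAdjoint A := hA.1
  -- The convention `0⁻¹ = 0` makes the second function a pseudo-inverse on the kernel.
  refine ⟨cfc Real.sqrt A, cfc (fun x => (Real.sqrt x)⁻¹) A,
    Matrix.nonneg_iff_posSemidef.1 (cfc_nonneg fun x _ => Real.sqrt_nonneg x),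
    isHermitian_cfc _ _, ?_, ?_, ?_, ?_⟩
  · conv_rhs => rw [← cfc_id' ℝ A]
    rw [cfc_mul_cfc]
    exact cfc_congr fun x hx => Real.mul_self_sqrt (spectrum_nonneg_of_nonneg hA0 hx)
  · simp only [cfc_mul_cfc]
    exact cfc_congr fun x _ => mul_comm _ _
  · simp only [cfc_mul_cfc]
    exact cfc_congr fun x _ => mul_inv_mul_cancel _
  · simp only [cfc_mul_cfc]
    refine cfc_congr fun x _ => ?_
    by_cases h : √x = 0 <;> simp [h]

/-- The trace form of `3 s² v² ≤ 2 s³ v + v⁴` for `s, v ≥ 0`. -/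
lemma three_trace_sq_le {S V : Matrix ι ι ℂ} (hS : S.PosSemidef) (hV : V.PosSemidef) :
    3 * (S * S * (V * V)).trace.re
      ≤ 2 * (S * S * S * V).trace.re + (V * V * (V * V)).trace.re := by
  -- For scalars, `2s³v + v⁴ - 3s²v² = 2(s - v)²sv + (s - v)²v²`. The two terms are ordered here so
  -- that each trace is non-negative without commutativity.
  have h1 : 0 ≤ ((S - V) * S * (S - V) * V).trace.re := by
    refine re_trace_mul_nonneg ?_ hV
    have := hS.mul_mul_conjTranspose_same (S - V)
    rwa [Matrix.conjTranspose_sub, hS.1.eq, hV.1.eq] at this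
  have h2 : 0 ≤ ((S - V) * (S - V) * (V * V)).trace.re := by
    have := re_trace_mul_conjTranspose_nonneg (V * (S - V))
    rw [Matrix.conjTranspose_mul, Matrix.conjTranspose_sub, hS.1.eq, hV.1.eq,
      Matrix.trace_mul_comm] at this
    rw [Matrix.mul_assoc, Matrix.trace_mul_comm]
    simpa only [Matrix.mul_assoc] using this
  have c1 : (V * (S * (S * V))).trace = (S * (S * (V * V))).trace := by
    rw [Matrix.trace_mul_comm]; simp only [Matrix.mul_assoc]
  have c2 : (V * (S * (V * V))).trace = (S * (V * (V * V))).trace := by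
    rw [Matrix.trace_mul_comm]; simp only [Matrix.mul_assoc]
  simp only [Matrix.mul_assoc, Matrix.sub_mul, Matrix.mul_sub, Matrix.trace_sub,
    Complex.sub_re, c1, c2] at h1 h2 ⊢
  linarith

end MatrixAnalysis

/-! ### Characters of bit strings and syndrome projections. -/

section Characters

variable {n m r : ℕ}

lemma sgn_zero : sgn 0 = 1 := by simp [sgn]

lemma sgn_one : sgn 1 = -1 := by simp [sgn, ZMod.val_one]

lemma zmod_two_cases (a : ZMod 2) : a = 0 ∨ a = 1 := by
  revert a; decide

lemma sgn_add (a b : ZMod 2) : sgn (a + b) = sgn a * sgn b := by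
  rcases zmod_two_cases a with rfl | rfl <;> rcases zmod_two_cases b with rfl | rfl <;>
    simp [sgn_zero, sgn_one, CharTwo.add_self_eq_zero]

lemma sgn_mul_self (a : ZMod 2) : sgn a * sgn a = 1 := by
  rw [← sgn_add, CharTwo.add_self_eq_zero, sgn_zero]

lemma star_sgn (a : ZMod 2) : star (sgn a) = sgn a := by
  rcases zmod_two_cases a with rfl | rfl <;> simp [sgn_zero, sgn_one]

lemma half_one_add_sgn_mul_sgn (a b : ZMod 2) :
    (2 : ℂ)⁻¹ * (1 + sgn a * sgn b) = if b = a then 1 else 0 := by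
  rcases zmod_two_cases a with rfl | rfl <;> rcases zmod_two_cases b with rfl | rfl <;>
    norm_num [sgn_zero, sgn_one]

lemma sum_sgn_dotProduct (a : Bits n) :
    ∑ x : Bits n, sgn (x ⬝ᵥ a) = if a = 0 then 2 ^ n else 0 := by
  split_ifs with h
  · subst h
    simp [sgn_zero, ZMod.card]
  · obtain ⟨j, hj⟩ := Function.ne_iff.1 h
    have hj1 : a j = 1 := (zmod_two_cases (a j)).resolve_left hj
    -- Flipping a coordinate of `x` where `a` is `1` negates every summand, so the sum is its own
    -- negative.
    have h1 : ∑ x : Bits n, sgn (x ⬝ᵥ a) = ∑ x : Bits n, sgn ((x + Pi.single j 1) ⬝ᵥ a) :=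
      (Equiv.sum_comp (Equiv.addRight (Pi.single j 1 : Bits n)) fun x => sgn (x ⬝ᵥ a)).symm
    simp only [add_dotProduct, sgn_add, single_one_dotProduct, hj1, sgn_one, ← Finset.sum_mul] at h1
    linear_combination (1 / 2 : ℂ) * h1

lemma sub_eq_add_bits (a b : Bits n) : a - b = a + b :=
  funext fun j => CharTwo.sub_eq_add (a j) (b j)

lemma add_eq_zero_iff_eq_bits (a b : Bits n) : a + b = 0 ↔ a = b := by
  rw [← sub_eq_add_bits, sub_eq_zero]

lemma sum_sgn_mul_sgn (a b : Bits n) :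
    ∑ x : Bits n, sgn (x ⬝ᵥ a) * sgn (x ⬝ᵥ b) = if a = b then 2 ^ n else 0 := by
  simp only [← sgn_add, ← dotProduct_add, sum_sgn_dotProduct, add_eq_zero_iff_eq_bits]

lemma sum_sgn_mul_sgn' (a b : Bits n) :
    ∑ x : Bits n, sgn (a ⬝ᵥ x) * sgn (b ⬝ᵥ x) = if a = b then 2 ^ n else 0 := by
  simp only [← sum_sgn_mul_sgn, dotProduct_comm]

lemma syndrome_factor_mulVec (c x : Bits n) (s : ZMod 2) :
    ((2 : ℂ)⁻¹ • (1 + sgn s • pauliX c)) *ᵥ (fun a => sgn (x ⬝ᵥ a))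
      = (if c ⬝ᵥ x = s then (1 : ℂ) else 0) • fun a => sgn (x ⬝ᵥ a) := by
  have hX : pauliX c *ᵥ (fun a => sgn (x ⬝ᵥ a)) = sgn (c ⬝ᵥ x) • fun a => sgn (x ⬝ᵥ a) := by
    funext b
    have : ∀ a : Bits n, b = a + c ↔ a = b + c := fun a => by
      rw [← sub_eq_add_bits b c, eq_sub_iff_add_eq, eq_comm]
    simp [pauliX, Matrix.mulVec, dotProduct, this]
    change sgn (x ⬝ᵥ (b + c)) = sgn (c ⬝ᵥ x) * sgn (x ⬝ᵥ b)
    rw [dotProduct_add, sgn_add, mul_comm, dotProduct_comm x c]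
  rw [Matrix.smul_mulVec, Matrix.add_mulVec, Matrix.smul_mulVec, Matrix.one_mulVec, hX,
    ← half_one_add_sgn_mul_sgn]
  module

/-- Characters are simultaneous eigenvectors of the `X^{h_j}`; each factor tests one bit of the
syndrome. -/
lemma syndromeProj_mulVec (h : Matrix (Fin r) (Fin n) (ZMod 2)) (s : Bits r) (x : Bits n) :
    syndromeProj h s *ᵥ (fun a => sgn (x ⬝ᵥ a))
      = (if h *ᵥ x = s then (1 : ℂ) else 0) • fun a => sgn (x ⬝ᵥ a) := by
  induction r with
  | zero =>
    have : h *ᵥ x = s := Subsingleton.elim _ _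
    simp [syndromeProj, this]
  | succ r ih =>
    have h1 : syndromeProj h s = ((2 : ℂ)⁻¹ • (1 + sgn (s 0) • pauliX (h.row 0))) *
        syndromeProj (h.submatrix Fin.succ id) (fun j => s j.succ) := by
      simp only [syndromeProj, List.ofFn_succ, List.prod_cons]
      rfl
    have h2 : h *ᵥ x = s ↔ h.row 0 ⬝ᵥ x = s 0 ∧
        h.submatrix Fin.succ id *ᵥ x = fun j => s j.succ := by
      simp only [funext_iff, Fin.forall_fin_succ]
      rfl
    rw [h1, ← Matrix.mulVec_mulVec, ih, Matrix.mulVec_smul, syndrome_factor_mulVec, smul_smul]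
    congr 1
    simp only [h2]
    by_cases ha : h.row 0 ⬝ᵥ x = s 0 <;> simp [ha]

lemma syndromeProj_apply (h : Matrix (Fin r) (Fin n) (ZMod 2)) (s : Bits r) (a b : Bits n) :
    syndromeProj h s a b
      = ((2 : ℂ) ^ n)⁻¹ * ∑ x with h *ᵥ x = s, sgn (x ⬝ᵥ a) * sgn (x ⬝ᵥ b) := by
  have h1 : ∀ x : Bits n, ∑ c, syndromeProj h s a c * sgn (x ⬝ᵥ c)
      = if h *ᵥ x = s then sgn (x ⬝ᵥ a) else 0 := fun x => by
    have := congrFun (syndromeProj_mulVec h s x) a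
    simpa [Matrix.mulVec, dotProduct] using this
  have h2 : (2 : ℂ) ^ n * syndromeProj h s a b
      = ∑ x, (∑ c, syndromeProj h s a c * sgn (x ⬝ᵥ c)) * sgn (x ⬝ᵥ b) := by
    simp only [Finset.sum_mul, mul_assoc]
    rw [Finset.sum_comm]
    simp only [← Finset.mul_sum, sum_sgn_mul_sgn]
    simp [mul_comm]
  rw [eq_inv_mul_iff_mul_eq₀ (by positivity), h2]
  simp only [h1, ite_mul, zero_mul, Finset.sum_filter]

/-- The phase-basis expansion of the syndrome projections resolves the identity. -/
lemma sum_normSq_syndromeProj (h : Matrix (Fin r) (Fin n) (ZMod 2)) (b : Bits n) :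
    ∑ s, ∑ a, syndromeProj h s a b * star (syndromeProj h s a b) = 1 := by
  -- The squared norm of a column of a projection is its diagonal entry, here the fraction of phases
  -- `x` with syndrome `s`.
  have h1 : ∀ s, ∑ a, syndromeProj h s a b * star (syndromeProj h s a b)
      = ((2 : ℂ) ^ n)⁻¹ * ∑ x, if h *ᵥ x = s then 1 else 0 := by
    intro s
    have h2 : ∀ a, star (syndromeProj h s a b) = syndromeProj h s a b := fun a => by
      simp [syndromeProj_apply, star_sgn]
    have h3 : ∀ x : Bits n, ∑ a, syndromeProj h s a b * sgn (x ⬝ᵥ a)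
        = if h *ᵥ x = s then sgn (x ⬝ᵥ b) else 0 := by
      intro x
      simp only [syndromeProj_apply, Finset.mul_sum, Finset.sum_mul]
      rw [Finset.sum_comm]
      have : ∀ y : Bits n, ∑ a : Bits n, ((2 : ℂ) ^ n)⁻¹ * (sgn (y ⬝ᵥ a) * sgn (y ⬝ᵥ b)) *
          sgn (x ⬝ᵥ a) = if y = x then sgn (x ⬝ᵥ b) else 0 := by
        intro y
        have : ∀ a : Bits n, ((2 : ℂ) ^ n)⁻¹ * (sgn (y ⬝ᵥ a) * sgn (y ⬝ᵥ b)) * sgn (x ⬝ᵥ a)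
            = ((2 : ℂ) ^ n)⁻¹ * sgn (y ⬝ᵥ b) * (sgn (y ⬝ᵥ a) * sgn (x ⬝ᵥ a)) := fun a => by ring
        simp only [this, ← Finset.mul_sum, sum_sgn_mul_sgn']
        split_ifs with hyx
        · subst hyx; field_simp
        · simp
      simp [this, Finset.sum_ite_eq']
    simp only [h2]
    calc ∑ a, syndromeProj h s a b * syndromeProj h s a b
        = ((2 : ℂ) ^ n)⁻¹ * ∑ x with h *ᵥ x = s,
            (∑ a, syndromeProj h s a b * sgn (x ⬝ᵥ a)) * sgn (x ⬝ᵥ b) := by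
          simp only [Finset.sum_mul]
          rw [Finset.sum_comm, Finset.mul_sum]
          refine Finset.sum_congr rfl fun a _ => ?_
          nth_rewrite 2 [syndromeProj_apply]
          simp only [Finset.mul_sum]
          exact Finset.sum_congr rfl fun x _ => by ring
      _ = _ := by
          rw [Finset.sum_filter]
          congr 1
          refine Finset.sum_congr rfl fun x _ => ?_
          rw [h3]
          split_ifs <;> simp [sgn_mul_self]
  simp only [h1, ← Finset.mul_sum]
  rw [Finset.sum_comm]
  simp [ZMod.card]

end Characters

/-! ### Duality between the hash function and its check matrix. -/

section CheckMatrix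

variable {n m : ℕ} {g : Bits n →ₗ[ZMod 2] Bits m} {h : Matrix (Fin (n - m)) (Fin n) (ZMod 2)}

/-- The transpose of a linear map with respect to the dot products. -/
lemma vecMul_toMatrix_dotProduct (g : Bits n →ₗ[ZMod 2] Bits m) (u : Bits m) (a : Bits n) :
    (u ᵥ* LinearMap.toMatrix' g) ⬝ᵥ a = u ⬝ᵥ g a := by
  rw [← Matrix.dotProduct_mulVec, LinearMap.toMatrix'_mulVec]

lemma vecMul_toMatrix_injective (hg : Function.Surjective g) :
    Function.Injective fun u : Bits m => u ᵥ* LinearMap.toMatrix' g := by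
  intro u v huv
  refine dotProduct_eq _ _ fun k => ?_
  obtain ⟨a, rfl⟩ := hg k
  have := congrArg (· ⬝ᵥ a) huv
  simpa only [vecMul_toMatrix_dotProduct] using this

/-- The kernel of a check matrix of `(ker g)^⊥` is the row space of `g`. -/
lemma IsCheckMatrix.mulVec_eq_zero_iff (hh : IsCheckMatrix g h) (hg : Function.Surjective g)
    (x : Bits n) : h *ᵥ x = 0 ↔ ∃ u : Bits m, u ᵥ* LinearMap.toMatrix' g = x := by
  rw [hh x]
  constructor
  · intro hx
    choose t ht using hg
    -- A functional vanishing on `ker g` factors through `g`; `u` lists its values on preimages of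
    -- the standard basis.
    refine ⟨fun j => x ⬝ᵥ t (Pi.single j 1), dotProduct_eq _ _ fun a => ?_⟩
    have h1 : g (a - ∑ j, g a j • t (Pi.single j 1)) = 0 := by
      rw [map_sub, map_sum, sub_eq_zero]
      funext i
      simp [ht, Finset.sum_apply, Pi.single_apply]
    have h2 := hx _ h1
    rw [dotProduct_sub, sub_eq_zero, dotProduct_sum] at h2
    rw [vecMul_toMatrix_dotProduct, h2]
    simp only [dotProduct_smul, smul_eq_mul]
    exact Finset.sum_congr rfl fun j _ => mul_comm _ _
  · rintro ⟨u, rfl⟩ a ha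
    rw [vecMul_toMatrix_dotProduct, ha, dotProduct_zero]

/-- Summing characters over a coset of the code `(ker g)^⊥`. -/
lemma IsCheckMatrix.sum_sgn_coset (hh : IsCheckMatrix g h) (hg : Function.Surjective g)
    (z a b : Bits n) :
    ∑ x with h *ᵥ x = h *ᵥ z, sgn (x ⬝ᵥ a) * sgn (x ⬝ᵥ b)
      = if g a = g b then 2 ^ m * (sgn (z ⬝ᵥ a) * sgn (z ⬝ᵥ b)) else 0 := by
  have h1 : ∑ u : Bits m, sgn ((z + u ᵥ* LinearMap.toMatrix' g) ⬝ᵥ a) *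
      sgn ((z + u ᵥ* LinearMap.toMatrix' g) ⬝ᵥ b)
      = ∑ x with h *ᵥ x = h *ᵥ z, sgn (x ⬝ᵥ a) * sgn (x ⬝ᵥ b) := by
    refine Finset.sum_nbij (fun u => z + u ᵥ* LinearMap.toMatrix' g) ?_ ?_ ?_ fun _ _ => rfl
    · intro u _
      have := (hh.mulVec_eq_zero_iff hg _).2 ⟨u, rfl⟩
      simp only [Finset.mem_filter, Finset.mem_univ, true_and, Matrix.mulVec_add, this, add_zero]
    · intro u _ v _ huv
      exact vecMul_toMatrix_injective hg (add_left_cancel huv)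
    · intro x hx
      have hx' : h *ᵥ x = h *ᵥ z := by simpa using hx
      have h0 : h *ᵥ (x - z) = 0 := by rw [Matrix.mulVec_sub, hx', sub_self]
      obtain ⟨u, hu⟩ := (hh.mulVec_eq_zero_iff hg _).1 h0
      exact ⟨u, by simp, by simp [hu]⟩
  have h2 : ∀ u : Bits m, sgn ((z + u ᵥ* LinearMap.toMatrix' g) ⬝ᵥ a) *
      sgn ((z + u ᵥ* LinearMap.toMatrix' g) ⬝ᵥ b)
      = (sgn (z ⬝ᵥ a) * sgn (z ⬝ᵥ b)) * (sgn (u ⬝ᵥ g a) * sgn (u ⬝ᵥ g b)) := fun u => by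
    simp only [add_dotProduct, sgn_add, vecMul_toMatrix_dotProduct]
    ring
  rw [← h1]
  simp only [h2, ← Finset.mul_sum, sum_sgn_mul_sgn, mul_ite, mul_zero]
  simp only [mul_comm]

/-- A character sum over a coset of the row space of `g` vanishes unless `g a = g b`. A syndrome
that does not occur gives an empty sum, since `h` need not have full rank. -/
lemma IsCheckMatrix.syndromeProj_eq_zero (hh : IsCheckMatrix g h) (hg : Function.Surjective g)
    (s : Bits (n - m)) {a b : Bits n} (hab : g a ≠ g b) : syndromeProj h s a b = 0 := by
  rw [syndromeProj_apply]
  by_cases hs : ∃ z, h *ᵥ z = s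
  · obtain ⟨z, rfl⟩ := hs
    rw [hh.sum_sgn_coset hg, if_neg hab, mul_zero]
  · push Not at hs
    simp [hs]

lemma two_pow_mul_card_fiber (hg : Function.Surjective g) (k : Bits m) :
    (2 : ℂ) ^ m * (Finset.univ.filter fun a => g a = k).card = 2 ^ n := by
  calc (2 : ℂ) ^ m * (Finset.univ.filter fun a => g a = k).card
      = ∑ a, ∑ u : Bits m, sgn (u ⬝ᵥ g a) * sgn (u ⬝ᵥ k) := by
        simp [sum_sgn_mul_sgn, Finset.sum_ite, mul_comm ((2 : ℂ) ^ m)]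
    _ = ∑ u : Bits m, (∑ a, sgn (a ⬝ᵥ (u ᵥ* LinearMap.toMatrix' g))) * sgn (u ⬝ᵥ k) := by
        rw [Finset.sum_comm]
        simp only [Finset.sum_mul, ← vecMul_toMatrix_dotProduct, dotProduct_comm _ (_ ᵥ* _)]
    _ = 2 ^ n := by
        have : ∀ u : Bits m, u ᵥ* LinearMap.toMatrix' g = 0 ↔ u = 0 := fun u =>
          ⟨fun hu => vecMul_toMatrix_injective hg (by simpa using hu), fun hu => by simp [hu]⟩
        simp [sum_sgn_dotProduct, this, sgn_zero]

end CheckMatrix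

/-! ### Phase error correction in components. -/

section PhaseErrorCorrection

set_option linter.unusedSectionVars false

variable {n m r : ℕ} {E A' : Type*} [Fintype A'] [DecidableEq A'] [Fintype E] [DecidableEq E]

/-- The component `⟨a|_A Ψ` of a vector of `A ⊗ E ⊗ A'`, as a matrix from `A'` to `E`. -/
def block (Ψ : (Bits n × E) × A' → ℂ) (a : Bits n) : Matrix E A' ℂ :=
  Matrix.of fun ε α => Ψ ((a, ε), α)

/-- The component `⟨x~|_A Ψ` of a vector of `A ⊗ E ⊗ A'` with components `f a = ⟨a|_A Ψ`. -/
def phaseBlock (f : Bits n → Matrix E A' ℂ) (x : Bits n) : Matrix E A' ℂ :=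
  (((Real.sqrt (2 ^ n))⁻¹ : ℝ) : ℂ) • ∑ a, sgn (x ⬝ᵥ a) • f a

/-- The components of the unnormalized state after phase error correction with outcomes
`s` and `e`. -/
def pecBlock (h : Matrix (Fin r) (Fin n) (ZMod 2)) (M : Bits r → Bits n → Matrix A' A' ℂ)
    (f : Bits n → Matrix E A' ℂ) (s : Bits r) (e a : Bits n) : Matrix E A' ℂ :=
  sgn (e ⬝ᵥ a) • ∑ b, syndromeProj h s a b • (f b * (M s e)ᵀ)

/-- The probability that phase error correction succeeds. -/
def pecSuccess (h : Matrix (Fin r) (Fin n) (ZMod 2)) (M : Bits r → Bits n → Matrix A' A' ℂ)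
    (f : Bits n → Matrix E A' ℂ) : ℝ :=
  ∑ e, ((phaseBlock f e * (M (h *ᵥ e) e)ᵀ) * (phaseBlock f e * (M (h *ᵥ e) e)ᵀ)ᴴ).trace.re

lemma ofReal_inv_sqrt_mul_self (n : ℕ) :
    (((Real.sqrt (2 ^ n))⁻¹ : ℝ) : ℂ) * (((Real.sqrt (2 ^ n))⁻¹ : ℝ) : ℂ) = ((2 : ℂ) ^ n)⁻¹ := by
  rw [← Complex.ofReal_mul, ← mul_inv, Real.mul_self_sqrt (by positivity)]
  push_cast
  rfl

lemma phaseBlock_gram (f f' : Bits n → Matrix E A' ℂ) (x : Bits n) :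
    phaseBlock f x * (phaseBlock f' x)ᴴ = ((2 : ℂ) ^ n)⁻¹ •
      ∑ a, ∑ b, (sgn (x ⬝ᵥ a) * sgn (x ⬝ᵥ b)) • (f a * (f' b)ᴴ) := by
  simp only [phaseBlock, Matrix.conjTranspose_smul, Matrix.smul_mul, Matrix.mul_smul, smul_smul,
    Complex.star_def, Complex.conj_ofReal, ofReal_inv_sqrt_mul_self]
  simp only [Matrix.conjTranspose_smul, Matrix.conjTranspose_sum, star_sgn, Matrix.smul_mul,
    Matrix.mul_smul, Matrix.sum_mul, Matrix.mul_sum, ← smul_smul]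
  rw [Finset.sum_comm]
  simp only [Finset.smul_sum]
  refine Finset.sum_congr rfl fun a _ => Finset.sum_congr rfl fun b _ => ?_
  rw [smul_comm (sgn (x ⬝ᵥ a))]

/-- Parseval's identity in matrix form. -/
lemma sum_phaseBlock_gram (f f' : Bits n → Matrix E A' ℂ) :
    ∑ x, phaseBlock f x * (phaseBlock f' x)ᴴ = ∑ a, f a * (f' a)ᴴ := by
  simp only [phaseBlock_gram, ← Finset.smul_sum]
  have h1 : ∑ x, ∑ a, ∑ b, (sgn (x ⬝ᵥ a) * sgn (x ⬝ᵥ b)) • (f a * (f' b)ᴴ)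
      = ∑ a, ∑ b, (∑ x, sgn (x ⬝ᵥ a) * sgn (x ⬝ᵥ b)) • (f a * (f' b)ᴴ) := by
    rw [Finset.sum_comm]
    refine Finset.sum_congr rfl fun a _ => ?_
    rw [Finset.sum_comm]
    simp only [Finset.sum_smul]
  rw [h1]
  simp [sum_sgn_mul_sgn, Finset.smul_sum, smul_smul]

lemma block_pecKraus_mulVec (h : Matrix (Fin r) (Fin n) (ZMod 2))
    (M : Bits r → Bits n → Matrix A' A' ℂ) (Ψ : (Bits n × E) × A' → ℂ) (s : Bits r)
    (e a : Bits n) :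
    block (pecKraus E h M s e *ᵥ Ψ) a = pecBlock h M (block Ψ) s e a := by
  ext ε α
  change ∑ j, pecKraus E h M s e ((a, ε), α) j * Ψ j = _
  simp only [block, pecBlock, pecKraus,
    Fintype.sum_prod_type, Matrix.kroneckerMap_apply, pauliZ, Matrix.diagonal_mul,
    Matrix.smul_apply, Matrix.sum_apply, smul_eq_mul, Matrix.one_apply]
  simp only [Matrix.mul_apply, Matrix.of_apply, Matrix.transpose_apply, Finset.mul_sum]
  refine Finset.sum_congr rfl fun b _ => ?_
  rw [Finset.sum_eq_single ε]
  · exact Finset.sum_congr rfl fun β _ => by simp; ring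
  · intro ε' _ hε
    simp [hε.symm]
  · simp

lemma traceRight_traceRight_ketBra (Ψ : (Bits n × E) × A' → ℂ) (a b : Bits n) :
    traceRight (traceRight (ketBra Ψ)) a b = (block Ψ a * (block Ψ b)ᴴ).trace := by
  simp [traceRight, ketBra, block, Matrix.vecMulVec_apply, Matrix.trace, Matrix.mul_apply]

lemma pecState_eq (h : Matrix (Fin r) (Fin n) (ZMod 2))
    (M : Bits r → Bits n → Matrix A' A' ℂ) (Ψ : (Bits n × E) × A' → ℂ) :
    pecState h M Ψ = ∑ s, ∑ e, ketBra (pecKraus E h M s e *ᵥ Ψ) := by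
  simp only [pecState, ketBra, Matrix.mul_vecMulVec, Matrix.vecMulVec_mul, Matrix.star_mulVec]

lemma traceRight_sum {ι κ σ : Type*} [Fintype κ] (t : Finset σ)
    (f : σ → Matrix (ι × κ) (ι × κ) ℂ) :
    traceRight (∑ i ∈ t, f i) = ∑ i ∈ t, traceRight (f i) := by
  ext i j
  simp only [traceRight, Matrix.of_apply, Matrix.sum_apply]
  exact Finset.sum_comm

/-- `Z^e` moves the phase `e` to `0`, and the syndrome projection retains that phase exactly when
`e` has syndrome `s`. Thus correction succeeds when the guess equals the actual phase. -/
lemma phaseBlock_zero_pecBlock (h : Matrix (Fin r) (Fin n) (ZMod 2))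
    (M : Bits r → Bits n → Matrix A' A' ℂ) (f : Bits n → Matrix E A' ℂ) (s : Bits r)
    (e : Bits n) :
    phaseBlock (pecBlock h M f s e) 0
      = if h *ᵥ e = s then phaseBlock f e * (M s e)ᵀ else 0 := by
  have h1 : ∀ b, ∑ a, sgn (e ⬝ᵥ a) * syndromeProj h s a b
      = if h *ᵥ e = s then sgn (e ⬝ᵥ b) else 0 := by
    intro b
    simp only [syndromeProj_apply, Finset.mul_sum]
    rw [Finset.sum_comm]
    have : ∀ y : Bits n, ∑ a : Bits n, sgn (e ⬝ᵥ a) *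
        (((2 : ℂ) ^ n)⁻¹ * (sgn (y ⬝ᵥ a) * sgn (y ⬝ᵥ b)))
          = if y = e then sgn (e ⬝ᵥ b) else 0 := by
      intro y
      have : ∀ a : Bits n, sgn (e ⬝ᵥ a) * (((2 : ℂ) ^ n)⁻¹ * (sgn (y ⬝ᵥ a) * sgn (y ⬝ᵥ b)))
          = ((2 : ℂ) ^ n)⁻¹ * sgn (y ⬝ᵥ b) * (sgn (y ⬝ᵥ a) * sgn (e ⬝ᵥ a)) := fun a => by ring
      simp only [this, ← Finset.mul_sum, sum_sgn_mul_sgn']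
      split_ifs with hye
      · subst hye; field_simp
      · simp
    simp [this, Finset.sum_ite_eq']
  have h2 : ∑ a, pecBlock h M f s e a
      = ∑ b, (∑ a, sgn (e ⬝ᵥ a) * syndromeProj h s a b) • (f b * (M s e)ᵀ) := by
    simp only [pecBlock, Finset.smul_sum, smul_smul, Finset.sum_smul]
    exact Finset.sum_comm
  simp only [phaseBlock, zero_dotProduct, sgn_zero, one_smul, h2, h1]
  split_ifs <;> simp [Matrix.sum_mul]

lemma re_sum_phaseBlock_zero_pecBlock (h : Matrix (Fin r) (Fin n) (ZMod 2))
    (M : Bits r → Bits n → Matrix A' A' ℂ) (f : Bits n → Matrix E A' ℂ) :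
    (∑ s, ∑ e, (phaseBlock (pecBlock h M f s e) 0 *
      (phaseBlock (pecBlock h M f s e) 0)ᴴ).trace).re = pecSuccess h M f := by
  simp only [phaseBlock_zero_pecBlock, pecSuccess, Complex.re_sum]
  rw [Finset.sum_comm]
  refine Finset.sum_congr rfl fun e _ => ?_
  rw [Finset.sum_eq_single (h *ᵥ e)]
  · simp
  · intro s _ hs
    simp [hs.symm]
  · simp

lemma phaseErrorProb_pecState (h : Matrix (Fin r) (Fin n) (ZMod 2))
    (M : Bits r → Bits n → Matrix A' A' ℂ) (Ψ : (Bits n × E) × A' → ℂ) :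
    phaseErrorProb (pecState h M Ψ)
      = (∑ s, ∑ e, ∑ a, pecBlock h M (block Ψ) s e a *
          (pecBlock h M (block Ψ) s e a)ᴴ).trace.re - pecSuccess h M (block Ψ) := by
  have h1 : ∀ a b, traceRight (traceRight (pecState h M Ψ)) a b
      = ∑ s, ∑ e, (pecBlock h M (block Ψ) s e a * (pecBlock h M (block Ψ) s e b)ᴴ).trace := by
    intro a b
    simp only [pecState_eq, traceRight_sum, Matrix.sum_apply, traceRight_traceRight_ketBra,
      block_pecKraus_mulVec]
  have h2 : ∀ s e, (phaseBlock (pecBlock h M (block Ψ) s e) 0 *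
      (phaseBlock (pecBlock h M (block Ψ) s e) 0)ᴴ).trace
      = ((2 : ℂ) ^ n)⁻¹ * ∑ a, ∑ b,
        (pecBlock h M (block Ψ) s e a * (pecBlock h M (block Ψ) s e b)ᴴ).trace := by
    intro s e
    simp only [phaseBlock_gram, zero_dotProduct, sgn_zero, one_smul, mul_one, Matrix.trace_smul,
      Matrix.trace_sum, smul_eq_mul]
  have h3 : star (phaseKet (0 : Bits n)) ⬝ᵥ (traceRight (traceRight (pecState h M Ψ)) *ᵥ phaseKet 0)
      = ∑ s, ∑ e, (phaseBlock (pecBlock h M (block Ψ) s e) 0 *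
      (phaseBlock (pecBlock h M (block Ψ) s e) 0)ᴴ).trace := by
    simp only [h2, ← Finset.mul_sum]
    have : ∀ z : Bits n, phaseKet (0 : Bits n) z = (((Real.sqrt (2 ^ n))⁻¹ : ℝ) : ℂ) := fun z => by
      simp [phaseKet, sgn_zero]
    simp only [dotProduct, Matrix.mulVec, Pi.star_apply, this, Complex.star_def,
      Complex.conj_ofReal, ← Finset.sum_mul, ← Finset.mul_sum, h1]
    rw [mul_comm _ (((Real.sqrt (2 ^ n))⁻¹ : ℝ) : ℂ), ← mul_assoc, ofReal_inv_sqrt_mul_self]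
    congr 1
    simp only [Finset.sum_comm (s := (Finset.univ : Finset (Bits n)))
      (t := (Finset.univ : Finset (Bits r)))]
    refine Finset.sum_congr rfl fun s _ => ?_
    rw [Finset.sum_comm (s := (Finset.univ : Finset (Bits n)))]
    conv_rhs => rw [Finset.sum_comm]
    rw [Finset.sum_comm]
    exact Finset.sum_congr rfl fun a _ => Finset.sum_comm
  rw [phaseErrorProb, h3, Complex.sub_re]
  congr 1
  · change (∑ a, traceRight (traceRight (pecState h M Ψ)) a a).re = _
    simp only [h1, Matrix.trace_sum]
    rw [Finset.sum_comm]
    exact congrArg _ (Finset.sum_congr rfl fun s _ => Finset.sum_comm)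
  · exact re_sum_phaseBlock_zero_pecBlock h M (block Ψ)

end PhaseErrorCorrection

/-! ### Purifications of the final and ideal key states. -/

section KeyStates

set_option linter.unusedSectionVars false

variable {n m : ℕ} {E A' G : Type*} [Fintype E] [DecidableEq E] [Fintype A'] [DecidableEq A']
  [Fintype G] [DecidableEq G]

lemma cqState_apply (ρ : Bits n → Matrix E E ℂ) (a b : Bits n) (ε ε' : E) :
    cqState ρ (a, ε) (b, ε') = if a = b then ρ a ε ε' else 0 := by
  simp only [cqState, Matrix.sum_apply, Matrix.kroneckerMap_apply, proj, Matrix.single_apply]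
  rw [Finset.sum_eq_single a]
  · by_cases h : a = b <;> simp [h]
  · intro c _ hc
    simp [hc]
  · simp

/-- The components of a purification of a cq state are orthogonal. -/
lemma IsPurification.block_mul {ρ : Bits n → Matrix E E ℂ} {Ψ : (Bits n × E) × A' → ℂ}
    (hΨ : IsPurification Ψ (cqState ρ)) (a b : Bits n) :
    block Ψ a * (block Ψ b)ᴴ = if a = b then ρ a else 0 := by
  ext ε ε'
  have h1 := congrFun (congrFun hΨ (a, ε)) (b, ε')
  rw [cqState_apply] at h1
  have h2 : (block Ψ a * (block Ψ b)ᴴ) ε ε' = if a = b then ρ a ε ε' else 0 := by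
    rw [← h1]
    simp [block, Matrix.mul_apply, traceRight, ketBra, Matrix.vecMulVec_apply]
  rw [h2]
  split_ifs <;> simp

variable {ρ : Bits n → Matrix E E ℂ} {f : Bits n → Matrix E A' ℂ}

/-- Completeness removes the ancilla operators, the signs of `Z^e` square to `1`, and orthogonality
of the components removes the cross terms. -/
lemma sum_pecBlock_gram_outcome {r : ℕ} (hf : ∀ a b, f a * (f b)ᴴ = if a = b then ρ a else 0)
    (h : Matrix (Fin r) (Fin n) (ZMod 2)) {M : Bits r → Bits n → Matrix A' A' ℂ}
    (hM : IsAncillaMeasurement M) (s : Bits r) (a : Bits n) :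
    ∑ e, pecBlock h M f s e a * (pecBlock h M f s e a)ᴴ
      = ∑ b, (syndromeProj h s a b * star (syndromeProj h s a b)) • ρ b := by
  set X : Matrix E A' ℂ := ∑ b, syndromeProj h s a b • f b with hX
  have h1 : ∀ e, pecBlock h M f s e a * (pecBlock h M f s e a)ᴴ
      = X * ((M s e)ᴴ * M s e)ᵀ * Xᴴ := by
    intro e
    have : pecBlock h M f s e a = sgn (e ⬝ᵥ a) • (X * (M s e)ᵀ) := by
      simp [pecBlock, hX, Matrix.sum_mul]
    rw [this, Matrix.conjTranspose_smul, Matrix.smul_mul, Matrix.mul_smul, smul_smul, star_sgn,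
      sgn_mul_self, one_smul, Matrix.conjTranspose_mul, Matrix.transpose_mul]
    simp only [Matrix.mul_assoc]
    rfl
  simp only [h1, ← Matrix.mul_sum, ← Matrix.sum_mul, ← Matrix.transpose_sum, hM s,
    Matrix.transpose_one, Matrix.mul_one]
  simp only [hX, Matrix.conjTranspose_sum, Matrix.conjTranspose_smul, Matrix.sum_mul,
    Matrix.mul_sum, Matrix.smul_mul, Matrix.mul_smul, hf]
  simp only [smul_ite, smul_zero, Finset.sum_ite_eq', Finset.mem_univ, if_true]
  exact Finset.sum_congr rfl fun b _ => by rw [smul_smul, mul_comm]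

/-- Phase error correction does not change the joint state of the hashed key and `E`. -/
lemma sum_pecBlock_gram (hf : ∀ a b, f a * (f b)ᴴ = if a = b then ρ a else 0)
    {g : Bits n →ₗ[ZMod 2] Bits m} (hg : Function.Surjective g)
    {h : Matrix (Fin (n - m)) (Fin n) (ZMod 2)} (hh : IsCheckMatrix g h)
    {M : Bits (n - m) → Bits n → Matrix A' A' ℂ}
    (hM : IsAncillaMeasurement M) (k : Bits m) :
    ∑ s, ∑ e, ∑ a with g a = k, pecBlock h M f s e a * (pecBlock h M f s e a)ᴴ
      = ∑ a with g a = k, ρ a := by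
  -- The syndrome projections are block diagonal with respect to the hash value, so a column at `b`
  -- contributes only to the key `g b`.
  have h1 : ∀ s b, ∑ a with g a = k, syndromeProj h s a b * star (syndromeProj h s a b)
      = if g b = k then ∑ a, syndromeProj h s a b * star (syndromeProj h s a b) else 0 := by
    intro s b
    rw [Finset.sum_filter]
    split_ifs with hb
    · refine Finset.sum_congr rfl fun a _ => ?_
      split_ifs with ha
      · rfl
      · rw [hh.syndromeProj_eq_zero hg s (fun hab => ha (hab.trans hb)), zero_mul]
    · refine Finset.sum_eq_zero fun a _ => ?_
      split_ifs with ha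
      · rw [hh.syndromeProj_eq_zero hg s (fun hab => hb (hab.symm.trans ha)), zero_mul]
      · rfl
  calc _ = ∑ s, ∑ a with g a = k, ∑ b,
          (syndromeProj h s a b * star (syndromeProj h s a b)) • ρ b := by
        refine Finset.sum_congr rfl fun s _ => ?_
        rw [Finset.sum_comm]
        exact Finset.sum_congr rfl fun a _ => sum_pecBlock_gram_outcome hf h hM s a
    _ = ∑ b, (∑ s, ∑ a with g a = k,
          syndromeProj h s a b * star (syndromeProj h s a b)) • ρ b := by
        simp only [Finset.sum_smul]
        rw [Finset.sum_comm (s := (Finset.univ : Finset (Bits n)))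
          (t := (Finset.univ : Finset (Bits (n - m))))]
        exact Finset.sum_congr rfl fun s _ => Finset.sum_comm
    _ = _ := by
        simp only [h1, Finset.sum_ite_irrel, Finset.sum_const_zero, sum_normSq_syndromeProj]
        simp [Finset.sum_filter]

lemma sum_pecBlock_gram_univ (hf : ∀ a b, f a * (f b)ᴴ = if a = b then ρ a else 0)
    {g : Bits n →ₗ[ZMod 2] Bits m} (hg : Function.Surjective g)
    {h : Matrix (Fin (n - m)) (Fin n) (ZMod 2)} (hh : IsCheckMatrix g h)
    {M : Bits (n - m) → Bits n → Matrix A' A' ℂ} (hM : IsAncillaMeasurement M) :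
    ∑ s, ∑ e, ∑ a, pecBlock h M f s e a * (pecBlock h M f s e a)ᴴ = ∑ a, ρ a := by
  rw [← Finset.sum_fiberwise Finset.univ g ρ]
  simp only [← sum_pecBlock_gram hf hg hh hM]
  conv_rhs => rw [Finset.sum_comm]
  refine Finset.sum_congr rfl fun s _ => ?_
  conv_rhs => rw [Finset.sum_comm]
  refine Finset.sum_congr rfl fun e _ => ?_
  rw [Finset.sum_fiberwise]

lemma IsPurification.phaseErrorProb_eq {Ψ : (Bits n × E) × A' → ℂ}
    (hΨ : IsPurification Ψ (cqState ρ))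
    {g : Bits n →ₗ[ZMod 2] Bits m} (hg : Function.Surjective g)
    {h : Matrix (Fin (n - m)) (Fin n) (ZMod 2)} (hh : IsCheckMatrix g h)
    {M : Bits (n - m) → Bits n → Matrix A' A' ℂ} (hM : IsAncillaMeasurement M) :
    phaseErrorProb (pecState h M Ψ) = (∑ a, ρ a).trace.re - pecSuccess h M (block Ψ) := by
  rw [phaseErrorProb_pecState, sum_pecBlock_gram_univ hΨ.block_mul hg hh hM]

lemma finalStateKE_apply (ρ : Bits n → Matrix E E ℂ) (g : Bits n → Bits m) (k l : Bits m)
    (ε ε' : E) :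
    finalStateKE ρ g (k, ε) (l, ε') = if k = l then (∑ a with g a = k, ρ a) ε ε' else 0 :=
  cqState_apply (fun k => ∑ a with g a = k, ρ a) k l ε ε'

lemma idealStateKE_apply (ρ : Bits n → Matrix E E ℂ) (k l : Bits m) (ε ε' : E) :
    idealStateKE m ρ (k, ε) (l, ε') = if k = l then ((2 : ℂ) ^ m)⁻¹ * (∑ a, ρ a) ε ε' else 0 := by
  have := cqState_apply (fun _ : Bits m => ∑ a, ρ a) k l ε ε'
  rw [cqState] at this
  rw [idealStateKE, Matrix.smul_apply, this]
  simp

/-- A purification of the final state after phase error correction; the last register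
is in the state `|0⟩`. -/
def finalPurif (g : Bits n → Bits m) {r : ℕ} (v : Bits r → Bits n → Bits n → Matrix E A' ℂ) :
    Matrix (Bits m × E) (((Bits r × Bits n) × (Bits n × A')) × Bits n) ℂ :=
  Matrix.of fun i j => if g j.1.2.1 = i.1 ∧ j.2 = 0 then
    v j.1.1.1 j.1.1.2 j.1.2.1 i.2 j.1.2.2 else 0

/-- A purification of the ideal state after phase error correction; the last register holds
the phase error. -/
def idealPurif (g : Bits n → Bits m) {r : ℕ} (v : Bits r → Bits n → Bits n → Matrix E A' ℂ) :
    Matrix (Bits m × E) (((Bits r × Bits n) × (Bits n × A')) × Bits n) ℂ :=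
  Matrix.of fun i j => if g j.1.2.1 = i.1 then
    (((Real.sqrt (2 ^ n))⁻¹ : ℝ) : ℂ) * phaseBlock (v j.1.1.1 j.1.1.2) j.2 i.2 j.1.2.2 else 0

lemma finalPurif_gram (g : Bits n → Bits m) {r : ℕ} (v : Bits r → Bits n → Bits n → Matrix E A' ℂ)
    (hv : ∀ k, ∑ s, ∑ e, ∑ a with g a = k, v s e a * (v s e a)ᴴ = ∑ a with g a = k, ρ a) :
    finalPurif g v * (finalPurif g v)ᴴ = finalStateKE ρ g := by
  ext ⟨k, ε⟩ ⟨l, ε'⟩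
  rw [finalStateKE_apply, ← hv, Matrix.mul_apply]
  simp only [Fintype.sum_prod_type, finalPurif, Matrix.of_apply, Matrix.conjTranspose_apply,
    Matrix.sum_apply, Finset.sum_filter]
  by_cases hkl : k = l
  · subst hkl
    simp only [if_true]
    refine Finset.sum_congr rfl fun s _ => Finset.sum_congr rfl fun e _ =>
      Finset.sum_congr rfl fun a _ => ?_
    by_cases ha : g a = k <;> simp [ha, Matrix.mul_apply]
  · rw [if_neg hkl]
    refine Finset.sum_eq_zero fun s _ => Finset.sum_eq_zero fun e _ =>
      Finset.sum_eq_zero fun a _ => Finset.sum_eq_zero fun α _ => Finset.sum_eq_zero fun x _ => ?_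
    by_cases ha : g a = k
    · simp [ha, hkl]
    · simp [ha]

/-- The uniform `A` register makes the key uniform and independent of `E`; tracing out the stored
phase recovers `ρ_E` by Parseval. -/
lemma idealPurif_gram {g : Bits n →ₗ[ZMod 2] Bits m} (hg : Function.Surjective g) {r : ℕ}
    (v : Bits r → Bits n → Bits n → Matrix E A' ℂ)
    (hv : ∑ s, ∑ e, ∑ a, v s e a * (v s e a)ᴴ = ∑ a, ρ a) :
    idealPurif g v * (idealPurif g v)ᴴ = idealStateKE m ρ := by
  ext ⟨k, ε⟩ ⟨l, ε'⟩
  have hv' : ∑ s, ∑ e, ∑ x, phaseBlock (v s e) x * (phaseBlock (v s e) x)ᴴ = ∑ a, ρ a := by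
    simp only [sum_phaseBlock_gram, hv]
  rw [idealStateKE_apply, ← hv', Matrix.mul_apply]
  by_cases hkl : k = l
  · subst hkl
    -- All fibers of `g` have equal size, so the weights `2^{-n}` on a fiber add up to `2^{-m}`.
    have hc : ((2 : ℂ) ^ m)⁻¹ = ∑ a with g a = k, ((2 : ℂ) ^ n)⁻¹ := by
      rw [Finset.sum_const, nsmul_eq_mul, ← two_pow_mul_card_fiber hg k]
      have : ((Finset.univ.filter fun a => g a = k).card : ℂ) ≠ 0 := fun h0 => by
        have := two_pow_mul_card_fiber hg k
        rw [h0, mul_zero] at this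
        exact absurd this.symm (by positivity)
      field_simp
    simp only [Fintype.sum_prod_type, idealPurif, Matrix.of_apply, Matrix.conjTranspose_apply,
      Matrix.sum_apply, if_true, Finset.mul_sum]
    refine Finset.sum_congr rfl fun s _ => Finset.sum_congr rfl fun e _ => ?_
    rw [← Finset.mul_sum, hc, Finset.sum_mul, Finset.sum_filter]
    refine Finset.sum_congr rfl fun a _ => ?_
    split_ifs with ha
    · simp only [Matrix.mul_apply, Finset.mul_sum, Matrix.conjTranspose_apply]
      rw [Finset.sum_comm]
      refine Finset.sum_congr rfl fun x _ => Finset.sum_congr rfl fun α _ => ?_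
      rw [star_mul', Complex.star_def, Complex.conj_ofReal, ← ofReal_inv_sqrt_mul_self]
      ring
    · simp
  · rw [if_neg hkl]
    refine Finset.sum_eq_zero fun j _ => ?_
    by_cases ha : g j.1.2.1 = k
    · simp [idealPurif, ha, hkl]
    · simp [idealPurif, ha]

/-- The last register of the final purification selects the phase `0`, and the constant amplitudes
of the ideal one sum `v s e a` over `a` into the same phase component. -/
lemma finalPurif_mul_idealPurif_trace (g : Bits n → Bits m) {r : ℕ}
    (v : Bits r → Bits n → Bits n → Matrix E A' ℂ) :
    (finalPurif g v * (idealPurif g v)ᴴ).trace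
      = ∑ s, ∑ e, (phaseBlock (v s e) 0 * (phaseBlock (v s e) 0)ᴴ).trace := by
  have h1 : ∀ s e, (phaseBlock (v s e) 0 * (phaseBlock (v s e) 0)ᴴ).trace
     = ∑ a, (((Real.sqrt (2 ^ n))⁻¹ : ℝ) : ℂ) * (v s e a * (phaseBlock (v s e) 0)ᴴ).trace := by
    intro s e
    nth_rewrite 1 [phaseBlock]
    simp only [zero_dotProduct, sgn_zero, one_smul, Matrix.smul_mul, Matrix.sum_mul,
      Matrix.trace_smul, Matrix.trace_sum, Finset.mul_sum, smul_eq_mul]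
  simp only [h1]
  rw [Matrix.trace_mul_comm]
  simp only [Matrix.trace, Matrix.diag_apply, Matrix.mul_apply, Fintype.sum_prod_type,
    finalPurif, idealPurif, Matrix.of_apply, Matrix.conjTranspose_apply, Finset.mul_sum]
  refine Finset.sum_congr rfl fun s _ => Finset.sum_congr rfl fun e _ =>
    Finset.sum_congr rfl fun a _ => ?_
  conv_rhs => rw [Finset.sum_comm]
  refine Finset.sum_congr rfl fun α _ => ?_
  rw [Finset.sum_eq_single 0, Finset.sum_eq_single (g a)]
  · refine Finset.sum_congr rfl fun ε _ => ?_
    simp only [if_true, and_self]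
    rw [star_mul', Complex.star_def, Complex.conj_ofReal]
    ring
  · intro k _ hk
    simp [hk.symm]
  · simp
  · intro x _ hx
    simp [hx]
  · simp

end KeyStates

/-! ### From the failure probability to the trace distance. -/

section SecrecyBound

set_option linter.unusedSectionVars false

variable {n m : ℕ} {E A' G : Type*} [Fintype E] [DecidableEq E] [Fintype A'] [DecidableEq A']
  [Fintype G] [DecidableEq G]

/-- The direct sum of the matrices `√p_i V_i`. -/
def mixturePurif {κ γ : Type*} (p : G → ℝ) (V : G → Matrix κ γ ℂ) :
    Matrix (κ × G) (γ × G) ℂ :=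
  ∑ i, ((√(p i) : ℝ) : ℂ) • (V i ⊗ₖ proj i)

lemma mixturePurif_mul {κ γ : Type*} [Fintype γ] {p : G → ℝ} (hp : ∀ i, 0 ≤ p i)
    (V W : G → Matrix κ γ ℂ) :
    mixturePurif p V * (mixturePurif p W)ᴴ = publicMixture p fun i => V i * (W i)ᴴ := by
  simp only [mixturePurif, publicMixture, Matrix.conjTranspose_sum, Matrix.conjTranspose_smul,
    Matrix.sum_mul, Matrix.mul_sum, Matrix.smul_mul, Matrix.mul_smul,
    Matrix.conjTranspose_kronecker, ← Matrix.mul_kronecker_mul, Complex.star_def,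
    Complex.conj_ofReal]
  refine Finset.sum_congr rfl fun i _ => ?_
  rw [Finset.sum_eq_single i]
  · rw [smul_smul, ← Complex.ofReal_mul, Real.mul_self_sqrt (hp i)]
    simp [proj]
  · intro j _ hj
    have : (proj j : Matrix G G ℂ) * (proj i)ᴴ = 0 := by
      simp [proj, Matrix.single_mul_single_of_ne, hj]
    simp [this]
  · simp

lemma trace_publicMixture {κ : Type*} [Fintype κ] (p : G → ℝ) (τ : G → Matrix κ κ ℂ) :
    (publicMixture p τ).trace.re = ∑ i, p i * (τ i).trace.re := by
  simp [publicMixture, Matrix.trace_sum, Matrix.trace_kronecker, proj]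

lemma trace_finalStateKE (ρ : Bits n → Matrix E E ℂ) (g : Bits n → Bits m) :
    (finalStateKE ρ g).trace = (∑ a, ρ a).trace := by
  rw [← Finset.sum_fiberwise Finset.univ g ρ]
  simp [finalStateKE, Matrix.trace_sum, Matrix.trace_kronecker, proj]

lemma trace_idealStateKE (ρ : Bits n → Matrix E E ℂ) :
    (idealStateKE m ρ).trace = (∑ a, ρ a).trace := by
  simp [idealStateKE, Matrix.trace_sum, Matrix.trace_kronecker, proj, ZMod.card]

theorem secrecyDist_le {ρ : Bits n → Matrix E E ℂ} (hρ : IsSubnormalizedCQ ρ)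
    {Ψ : (Bits n × E) × A' → ℂ} (hΨ : IsPurification Ψ (cqState ρ))
    {p : G → ℝ} (hp : IsProbability p) {g : G → Bits n →ₗ[ZMod 2] Bits m}
    (hg : ∀ i, Function.Surjective (g i))
    {h : G → Matrix (Fin (n - m)) (Fin n) (ZMod 2)} (hh : ∀ i, IsCheckMatrix (g i) (h i))
    (M : G → Bits (n - m) → Bits n → Matrix A' A' ℂ) (hM : ∀ i, IsAncillaMeasurement (M i)) :
    secrecyDist p (fun i => ⇑(g i)) ρ ≤ 2 * √2 * √(avgFailureProb p h M Ψ) := by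
  set t : ℝ := (∑ a, ρ a).trace.re with ht
  have ht1 : t ≤ 1 := by rw [ht, Matrix.trace_sum]; exact hρ.2
  set v := fun i => pecBlock (h i) (M i) (block Ψ) with hv
  set V := fun i => finalPurif (g i) (v i)
  set W := fun i => idealPurif (g i) (v i)
  have hVV : ∀ i, V i * (V i)ᴴ = finalStateKE ρ (g i) := fun i =>
    finalPurif_gram _ _ fun k => sum_pecBlock_gram hΨ.block_mul (hg i) (hh i) (hM i) k
  have hWW : ∀ i, W i * (W i)ᴴ = idealStateKE m ρ := fun i =>
    idealPurif_gram (hg i) _ (sum_pecBlock_gram_univ hΨ.block_mul (hg i) (hh i) (hM i))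
  have hVW : ∀ i, (V i * (W i)ᴴ).trace.re = t - phaseErrorProb (pecState (h i) (M i) Ψ) := by
    intro i
    rw [hΨ.phaseErrorProb_eq (hg i) (hh i) (hM i), finalPurif_mul_idealPurif_trace, ← ht,
      sub_sub_cancel]
    exact re_sum_phaseBlock_zero_pecBlock _ _ _
  have hVt : (mixturePurif p V * (mixturePurif p V)ᴴ).trace.re = t := by
    simp only [mixturePurif_mul hp.1, trace_publicMixture, hVV, trace_finalStateKE, ← ht,
      ← Finset.sum_mul, hp.2, one_mul]
  have hWt : (mixturePurif p W * (mixturePurif p W)ᴴ).trace.re = t := by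
    simp only [mixturePurif_mul hp.1, trace_publicMixture, hWW, trace_idealStateKE, ← ht,
      ← Finset.sum_mul, hp.2, one_mul]
  have key := traceNorm_gram_sub_gram_le (mixturePurif p V) (mixturePurif p W) t hVt hWt
  have ht0 : 0 ≤ t := hVt ▸ re_trace_mul_conjTranspose_nonneg _
  have hcs := re_trace_mul_conjTranspose_le (mixturePurif p V) (mixturePurif p W)
  rw [hVt, hWt, Real.sqrt_mul_self ht0] at hcs
  have hc : (mixturePurif p V * (mixturePurif p W)ᴴ).trace.re = t - avgFailureProb p h M Ψ := by
    simp only [mixturePurif_mul hp.1, trace_publicMixture, hVW, mul_sub, Finset.sum_sub_distrib,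
      ← Finset.sum_mul, hp.2, one_mul, avgFailureProb]
  rw [hc] at key hcs
  simp only [mixturePurif_mul hp.1, hVV, hWW] at key
  refine key.trans ?_
  rw [mul_assoc, ← Real.sqrt_mul (by norm_num)]
  gcongr
  -- With `P` the average failure, `t² - (t - P)² = P(2t - P) ≤ 2P`; Cauchy-Schwarz in `hcs`
  -- supplies `P ≥ 0`.
  nlinarith

end SecrecyBound

/-! ### Construction of the ancilla measurement. -/

section Measurement

set_option linter.unusedSectionVars false

variable {n m r : ℕ} {E A' : Type*} [Fintype A'] [DecidableEq A'] [Fintype E] [DecidableEq E]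

/-- A matrix `S` with its Moore-Penrose inverse `D`, where `S` is a fourth root of `A`. -/
structure IsFourthRootPinv (A S D : Matrix E E ℂ) : Prop where
  posSemidef : S.PosSemidef
  isHermitian : D.IsHermitian
  pow_four : S * S * (S * S) = A
  comm : S * D = D * S
  mul_mul_left : S * D * S = S
  mul_mul_right : D * S * D = D

lemma exists_isFourthRootPinv {A : Matrix E E ℂ} (hA : A.PosSemidef) :
    ∃ S D, IsFourthRootPinv A S D := by
  obtain ⟨B, -, hB, -, hBB, -⟩ := exists_sqrt_pinv hA
  obtain ⟨S, D, hS, hD, hSS, h1, h2, h3⟩ := exists_sqrt_pinv hB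
  exact ⟨S, D, hS, hD, by rw [hSS, hBB], h1, h2, h3⟩

lemma eq_zero_of_sum_gram {ι κ σ : Type*} [Fintype ι] [Fintype κ] [Fintype σ]
    {X : σ → Matrix ι κ ℂ} (h : ∑ a, X a * (X a)ᴴ = 0) (a : σ) : X a = 0 := by
  have h1 : ∑ a, (X a * (X a)ᴴ).trace = 0 := by rw [← Matrix.trace_sum, h, Matrix.trace_zero]
  have h2 := (Finset.sum_eq_zero_iff_of_nonneg fun a _ =>
    (Matrix.posSemidef_self_mul_conjTranspose (X a)).trace_nonneg).1 h1 a (Finset.mem_univ a)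
  exact Matrix.trace_mul_conjTranspose_self_eq_zero_iff.1 h2

lemma posSemidef_one_sub_of_idempotent {ι : Type*} [Fintype ι] [DecidableEq ι]
    {R : Matrix ι ι ℂ} (hH : Rᴴ = R) (hR : R * R = R) : (1 - R).PosSemidef := by
  have := Matrix.posSemidef_self_mul_conjTranspose (1 - R)
  rwa [Matrix.conjTranspose_sub, hH, Matrix.conjTranspose_one, Matrix.sub_mul, Matrix.mul_sub,
    Matrix.mul_sub, hR, Matrix.one_mul, Matrix.one_mul, Matrix.mul_one, sub_self, sub_zero] at this

/-- The range of each component of a purification lies in the support of the reduced state. -/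
lemma IsFourthRootPinv.mul_block {ρ : Bits n → Matrix E E ℂ} {f : Bits n → Matrix E A' ℂ}
    (hf : ∀ a b, f a * (f b)ᴴ = if a = b then ρ a else 0) {S D : Matrix E E ℂ}
    (hSD : IsFourthRootPinv (∑ a, ρ a) S D) (a : Bits n) : S * D * f a = f a := by
  -- The complementary projection kills `S`, hence `ρ_E = S⁴`, hence every component, because a sum
  -- of Gram matrices vanishes only termwise.
  have h0 : (1 - S * D) * S = 0 := by rw [Matrix.sub_mul, hSD.mul_mul_left, Matrix.one_mul, sub_self]
  have h1 : ∑ a, ((1 - S * D) * f a) * ((1 - S * D) * f a)ᴴ = 0 := by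
    have : ∀ a, ((1 - S * D) * f a) * ((1 - S * D) * f a)ᴴ
        = (1 - S * D) * ρ a * (1 - S * D)ᴴ := fun a => by
      have := hf a a
      rw [if_pos rfl] at this
      rw [← this, Matrix.conjTranspose_mul]
      simp only [Matrix.mul_assoc]
    simp only [this, ← Matrix.sum_mul, ← Matrix.mul_sum]
    rw [← hSD.pow_four, Matrix.mul_assoc S S, ← Matrix.mul_assoc _ S, h0]
    simp
  have h2 := eq_zero_of_sum_gram h1 a
  rw [Matrix.sub_mul, Matrix.one_mul, sub_eq_zero] at h2
  exact h2.symm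

/-- Completing a family of operators to ancilla measurements does not decrease the success
probability. -/
lemma exists_measurement_of_family (h : Matrix (Fin r) (Fin n) (ZMod 2))
    (f : Bits n → Matrix E A' ℂ) (F : Bits n → Matrix A' E ℂ)
    (hF : ∀ s, (1 - ∑ e with h *ᵥ e = s, F e * (F e)ᴴ).PosSemidef) :
    ∃ M : Bits r → Bits n → Matrix A' A' ℂ, IsAncillaMeasurement M ∧
      ∑ e, ((phaseBlock f e * F e) * (phaseBlock f e * F e)ᴴ).trace.re ≤ pecSuccess h M f := by
  -- The missing weight is assigned to the guess `e = 0`; any guess would do, as this only adds a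
  -- positive effect.
  set P : Bits r → Bits n → Matrix A' A' ℂ := fun s e =>
    (if h *ᵥ e = s then F e * (F e)ᴴ else 0) +
      if e = 0 then 1 - ∑ e with h *ᵥ e = s, F e * (F e)ᴴ else 0 with hP
  have hP0 : ∀ s e, ((P s e)ᵀ).PosSemidef := by
    intro s e
    refine Matrix.PosSemidef.transpose (Matrix.PosSemidef.add ?_ ?_)
    · split_ifs
      · exact Matrix.posSemidef_self_mul_conjTranspose _
      · exact Matrix.PosSemidef.zero
    · split_ifs
      · exact hF s
      · exact Matrix.PosSemidef.zero
  choose M hM using fun s e => CStarAlgebra.nonneg_iff_eq_star_mul_self.1 (hP0 s e).nonneg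
  simp only [Matrix.star_eq_conjTranspose] at hM
  refine ⟨M, fun s => ?_, ?_⟩
  · simp only [← hM, ← Matrix.transpose_sum, hP, Finset.sum_add_distrib]
    simp [Finset.sum_filter]
  · refine Finset.sum_le_sum fun e _ => ?_
    have h1 : (phaseBlock f e * (M (h *ᵥ e) e)ᵀ) * (phaseBlock f e * (M (h *ᵥ e) e)ᵀ)ᴴ
        = phaseBlock f e * P (h *ᵥ e) e * (phaseBlock f e)ᴴ := by
      rw [← Matrix.transpose_transpose (P (h *ᵥ e) e), hM, Matrix.transpose_mul,
        Matrix.conjTranspose_mul]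
      simp only [Matrix.mul_assoc]
      rfl
    have h2 : phaseBlock f e * P (h *ᵥ e) e * (phaseBlock f e)ᴴ
        = (phaseBlock f e * F e) * (phaseBlock f e * F e)ᴴ + phaseBlock f e *
          (if e = 0 then 1 - ∑ e' with h *ᵥ e' = h *ᵥ e, F e' * (F e')ᴴ else 0) *
          (phaseBlock f e)ᴴ := by
      simp only [hP, if_true, Matrix.mul_add, Matrix.add_mul, Matrix.conjTranspose_mul,
        Matrix.mul_assoc]
    rw [h1, h2, Matrix.trace_add, Complex.add_re]
    have h3 : (if e = 0 then 1 - ∑ e' with h *ᵥ e' = h *ᵥ e, F e' * (F e')ᴴ else 0).PosSemidef := by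
      split_ifs
      · exact hF _
      · exact Matrix.PosSemidef.zero
    have h4 := (Complex.le_def.1
      (h3.mul_mul_conjTranspose_same (phaseBlock f e)).trace_nonneg).1
    simpa using h4

lemma sum_sgn_smul {X : Type*} [AddCommGroup X] [Module ℂ X] (x : Bits n → Bits n → X) :
    ∑ e, ∑ a, ∑ b, (sgn (e ⬝ᵥ a) * sgn (e ⬝ᵥ b)) • x a b = (2 : ℂ) ^ n • ∑ a, x a a := by
  rw [Finset.sum_comm, Finset.smul_sum]
  refine Finset.sum_congr rfl fun a _ => ?_
  rw [Finset.sum_comm]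
  simp only [← Finset.sum_smul, sum_sgn_mul_sgn]
  simp

/-- The decoding operators on `A'`, built from operators `J k` on `E`. -/
def decoder (g : Bits n → Bits m) (f : Bits n → Matrix E A' ℂ) (J : Bits m → Matrix E E ℂ)
    (e : Bits n) : Matrix A' E ℂ :=
  (((√(2 ^ m))⁻¹ : ℝ) : ℂ) • ∑ a, sgn (e ⬝ᵥ a) • ((f a)ᴴ * J (g a))

/-- Summed over all phases, the characters retain only the terms with equal bit strings. -/
lemma sum_phaseBlock_mul_decoder {ρ : Bits n → Matrix E E ℂ} {f : Bits n → Matrix E A' ℂ}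
    (hf : ∀ a b, f a * (f b)ᴴ = if a = b then ρ a else 0) (g : Bits n → Bits m)
    (J : Bits m → Matrix E E ℂ) :
    ∑ e, phaseBlock f e * decoder g f J e
      = (((√(2 ^ n)) * (√(2 ^ m))⁻¹ : ℝ) : ℂ) • ∑ k, (∑ a with g a = k, ρ a) * J k := by
  have h1 : ∀ e, phaseBlock f e * decoder g f J e
      = (((√(2 ^ n))⁻¹ * (√(2 ^ m))⁻¹ : ℝ) : ℂ) • ∑ a, ∑ b,
          (sgn (e ⬝ᵥ a) * sgn (e ⬝ᵥ b)) • (f a * (f b)ᴴ * J (g b)) := by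
    intro e
    simp only [phaseBlock, decoder, Matrix.smul_mul, Matrix.mul_smul (M := Finset.sum _ _),
      smul_smul, Complex.ofReal_mul]
    simp only [Matrix.sum_mul, Matrix.mul_sum, Matrix.smul_mul, Matrix.mul_smul,
      Matrix.mul_assoc]
    congr 1
    simp only [Finset.smul_sum, smul_smul]
    rw [Finset.sum_comm]
    simp only [mul_comm]
  have h2 : ∑ a, ρ a * J (g a) = ∑ k, (∑ a with g a = k, ρ a) * J k := by
    rw [← Finset.sum_fiberwise Finset.univ g]
    refine Finset.sum_congr rfl fun k _ => ?_
    rw [Matrix.sum_mul]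
    refine Finset.sum_congr rfl fun a ha => ?_
    rw [(Finset.mem_filter.1 ha).2]
  simp only [h1, ← Finset.smul_sum]
  rw [sum_sgn_smul, ← h2, smul_smul]
  simp only [hf, if_true]
  congr 1
  have : (2 : ℂ) ^ n = ((√(2 ^ n) * √(2 ^ n) : ℝ) : ℂ) := by
    rw [Real.mul_self_sqrt (by positivity)]; push_cast; rfl
  rw [this, ← Complex.ofReal_mul]
  congr 1
  have : √((2 : ℝ) ^ n) ≠ 0 := by positivity
  field_simp

/-- Over one syndrome coset only pairs with equal hash values survive, so the sum splits by key, and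
the coset size `2^m` cancels the normalization. -/
lemma sum_decoder_gram {g : Bits n →ₗ[ZMod 2] Bits m} (hg : Function.Surjective g)
    {h : Matrix (Fin (n - m)) (Fin n) (ZMod 2)} (hh : IsCheckMatrix g h)
    (f : Bits n → Matrix E A' ℂ) (J : Bits m → Matrix E E ℂ) (z : Bits n) :
    ∑ e with h *ᵥ e = h *ᵥ z, decoder g f J e * (decoder g f J e)ᴴ
      = ∑ k, (∑ a with g a = k, sgn (z ⬝ᵥ a) • f a)ᴴ * (J k * (J k)ᴴ) *
          ∑ a with g a = k, sgn (z ⬝ᵥ a) • f a := by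
  have h1 : ∀ e, decoder g f J e * (decoder g f J e)ᴴ
      = ((2 : ℂ) ^ m)⁻¹ • ∑ a, ∑ b, (sgn (e ⬝ᵥ a) * sgn (e ⬝ᵥ b)) •
          ((f a)ᴴ * J (g a) * ((J (g b))ᴴ * f b)) := by
    intro e
    simp only [decoder, Matrix.conjTranspose_smul _ (Finset.sum _ _), Matrix.smul_mul,
      Matrix.mul_smul (M := Finset.sum _ _), smul_smul, Complex.star_def, Complex.conj_ofReal,
      ofReal_inv_sqrt_mul_self]
    simp only [Matrix.conjTranspose_sum, Matrix.conjTranspose_smul, star_sgn,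
      Matrix.conjTranspose_mul, Matrix.conjTranspose_conjTranspose, Matrix.sum_mul,
      Matrix.mul_sum, Matrix.smul_mul, Matrix.mul_smul]
    congr 1
    simp only [Finset.smul_sum, smul_smul]
    rw [Finset.sum_comm]
    simp only [mul_comm]
  have h2 : ∑ e with h *ᵥ e = h *ᵥ z, ∑ a, ∑ b, (sgn (e ⬝ᵥ a) * sgn (e ⬝ᵥ b)) •
      ((f a)ᴴ * J (g a) * ((J (g b))ᴴ * f b))
      = ∑ a, ∑ b, (if g a = g b then (2 : ℂ) ^ m * (sgn (z ⬝ᵥ a) * sgn (z ⬝ᵥ b)) else 0) •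
      ((f a)ᴴ * J (g a) * ((J (g b))ᴴ * f b)) := by
    rw [Finset.sum_comm]
    refine Finset.sum_congr rfl fun a _ => ?_
    rw [Finset.sum_comm]
    simp only [← Finset.sum_smul, hh.sum_sgn_coset hg]
  simp only [h1, ← Finset.smul_sum]
  rw [h2, ← Finset.sum_fiberwise Finset.univ g, Finset.smul_sum]
  refine Finset.sum_congr rfl fun k _ => ?_
  simp only [Matrix.conjTranspose_sum, Matrix.conjTranspose_smul, star_sgn, Matrix.sum_mul,
    Matrix.mul_sum, Matrix.smul_mul, Matrix.mul_smul, smul_smul, Finset.smul_sum]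
  rw [Finset.sum_comm (s := Finset.univ.filter fun a => g a = k)
    (t := Finset.univ.filter fun a => g a = k)]
  refine Finset.sum_congr rfl fun a ha => ?_
  rw [Finset.sum_filter]
  refine Finset.sum_congr rfl fun b _ => ?_
  rw [(Finset.mem_filter.1 ha).2]
  by_cases hb : g b = k
  · rw [if_pos hb.symm, if_pos hb, hb, inv_mul_cancel_left₀ (by positivity)]
    simp only [Matrix.mul_assoc, mul_comm]
  · rw [if_neg (Ne.symm hb), if_neg hb, mul_zero, zero_smul]

/-- If `(J k) (J k)†` is a pseudo-inverse of the state of `E` for the key `k`, then the decoding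
operators form a sub-normalized measurement. -/
lemma posSemidef_one_sub_sum_decoder_gram {ρ : Bits n → Matrix E E ℂ} {f : Bits n → Matrix E A' ℂ}
    (hf : ∀ a b, f a * (f b)ᴴ = if a = b then ρ a else 0)
    {g : Bits n →ₗ[ZMod 2] Bits m} (hg : Function.Surjective g)
    {h : Matrix (Fin (n - m)) (Fin n) (ZMod 2)} (hh : IsCheckMatrix g h)
    {J : Bits m → Matrix E E ℂ}
    (hJ : ∀ k, J k * (J k)ᴴ * (∑ a with g a = k, ρ a) * (J k * (J k)ᴴ) = J k * (J k)ᴴ)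
    (s : Bits (n - m)) :
    (1 - ∑ e with h *ᵥ e = s, decoder g f J e * (decoder g f J e)ᴴ).PosSemidef := by
  by_cases hs : ∃ z, h *ᵥ z = s
  · obtain ⟨z, rfl⟩ := hs
    set R := ∑ e with h *ᵥ e = h *ᵥ z, decoder g f J e * (decoder g f J e)ᴴ with hR
    have hRH : Rᴴ = R := by simp [hR, Matrix.conjTranspose_sum]
    -- The `Θ k` are orthogonal for distinct keys with `Θ k (Θ k)† = ρ_k`, so the
    -- generalized-inverse identity `hJ` makes each summand idempotent and the products of different
    -- summands zero.
    have hRR : R * R = R := by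
      rw [hR, sum_decoder_gram hg hh]
      set Θ : Bits m → Matrix E A' ℂ := fun k => ∑ a with g a = k, sgn (z ⬝ᵥ a) • f a with hΘ
      have hΘΘ : ∀ k l, Θ k * (Θ l)ᴴ = if k = l then ∑ a with g a = k, ρ a else 0 := by
        intro k l
        simp only [hΘ, Matrix.conjTranspose_sum, Matrix.conjTranspose_smul, star_sgn,
          Matrix.sum_mul, Matrix.mul_sum, Matrix.smul_mul, Matrix.mul_smul, hf,
          smul_ite, smul_zero, Finset.smul_sum, smul_smul]
        rw [Finset.sum_comm]
        split_ifs with hkl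
        · subst hkl
          refine Finset.sum_congr rfl fun a ha => ?_
          rw [Finset.sum_ite_eq, if_pos ha, sgn_mul_self, one_smul]
        · refine Finset.sum_eq_zero fun a ha => ?_
          rw [Finset.sum_ite_eq, if_neg]
          intro ha'
          exact hkl ((Finset.mem_filter.1 ha).2.symm.trans (Finset.mem_filter.1 ha').2)
      change (∑ k, (Θ k)ᴴ * (J k * (J k)ᴴ) * Θ k) * (∑ k, (Θ k)ᴴ * (J k * (J k)ᴴ) * Θ k)
        = ∑ k, (Θ k)ᴴ * (J k * (J k)ᴴ) * Θ k
      rw [Matrix.sum_mul]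
      refine Finset.sum_congr rfl fun k _ => ?_
      rw [Matrix.mul_sum, Finset.sum_eq_single k]
      · calc (Θ k)ᴴ * (J k * (J k)ᴴ) * Θ k * ((Θ k)ᴴ * (J k * (J k)ᴴ) * Θ k)
            = (Θ k)ᴴ * (J k * (J k)ᴴ * (Θ k * (Θ k)ᴴ) * (J k * (J k)ᴴ)) * Θ k := by
              simp only [Matrix.mul_assoc]
          _ = _ := by rw [hΘΘ, if_pos rfl, hJ]
      · intro l _ hl
        calc (Θ k)ᴴ * (J k * (J k)ᴴ) * Θ k * ((Θ l)ᴴ * (J l * (J l)ᴴ) * Θ l)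
            = (Θ k)ᴴ * (J k * (J k)ᴴ * (Θ k * (Θ l)ᴴ) * (J l * (J l)ᴴ)) * Θ l := by
              simp only [Matrix.mul_assoc]
          _ = 0 := by rw [hΘΘ, if_neg hl.symm]; simp
      · simp
    exact posSemidef_one_sub_of_idempotent hRH hRR
  · push Not at hs
    simp [hs, Matrix.PosSemidef.one]

end Measurement

/-! ### Success probability, collision probability and min-entropy. -/

section FailureBound

set_option linter.unusedSectionVars false

variable {n m : ℕ} {E A' G : Type*} [Fintype E] [DecidableEq E] [Fintype A'] [DecidableEq A']
  [Fintype G] [DecidableEq G]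

/-- For each hash function some ancilla measurements succeed with a probability bounded below in
terms of the collision probabilities relative to `ρ_E`. -/
lemma exists_measurement {ρ : Bits n → Matrix E E ℂ} (hρ : ∀ a, (ρ a).PosSemidef)
    {f : Bits n → Matrix E A' ℂ} (hf : ∀ a b, f a * (f b)ᴴ = if a = b then ρ a else 0)
    {S D : Matrix E E ℂ} (hSD : IsFourthRootPinv (∑ a, ρ a) S D)
    {g : Bits n →ₗ[ZMod 2] Bits m} (hg : Function.Surjective g)
    {h : Matrix (Fin (n - m)) (Fin n) (ZMod 2)} (hh : IsCheckMatrix g h) :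
    ∃ M : Bits (n - m) → Bits n → Matrix A' A' ℂ, IsAncillaMeasurement M ∧
      2 * (∑ a, ρ a).trace.re - 2 ^ m * ∑ k, (D * (∑ a with g a = k, ρ a) * D *
        (D * (∑ a with g a = k, ρ a) * D)).trace.re ≤ pecSuccess h M f := by
  set ρk : Bits m → Matrix E E ℂ := fun k => ∑ a with g a = k, ρ a with hρk
  have hρa : ∀ a, S * D * ρ a = ρ a := fun a => by
    have h1 := hf a a
    rw [if_pos rfl] at h1
    rw [← h1, ← Matrix.mul_assoc, hSD.mul_block hf]
  have hSDk : ∀ k, S * (D * ρk k) = ρk k := fun k => by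
    simp only [hρk, Matrix.mul_sum, ← Matrix.mul_assoc, hρa]
  have hYpos : ∀ k, (D * ρk k * D).PosSemidef := fun k => by
    have := (Matrix.posSemidef_sum (Finset.univ.filter fun a => g a = k)
      fun a _ => hρ a).mul_mul_conjTranspose_same D
    rwa [hSD.isHermitian.eq] at this
  choose V W hV hW hVV hVW hVWV hWVW using fun k => exists_sqrt_pinv (hYpos k)
  -- With `V k = (D ρ_k D)^{1/2}` and `W k` its pseudo-inverse, this choice gives both `ρ_k J k = S
  -- V k` and the identity required by the decoder.
  set J : Bits m → Matrix E E ℂ := fun k => D * W k with hJ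
  have hρJ : ∀ k, ρk k * J k = S * V k := fun k => by
    calc ρk k * J k = S * (D * ρk k * D) * W k := by
          rw [hJ]
          conv_lhs => rw [← hSDk k]
          simp only [Matrix.mul_assoc]
      _ = S * (V k * W k * V k) := by
          rw [← hVV, Matrix.mul_assoc, Matrix.mul_assoc, hVW, ← Matrix.mul_assoc (V k), hVW,
            Matrix.mul_assoc]
      _ = S * V k := by rw [hVWV]
  have hJJ : ∀ k, J k * (J k)ᴴ * ρk k * (J k * (J k)ᴴ) = J k * (J k)ᴴ := fun k => by
    rw [hJ]
    simp only [Matrix.conjTranspose_mul, (hW k).eq, hSD.isHermitian.eq]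
    have hw : W k * (V k * V k) * W k = W k * V k := by
      calc W k * (V k * V k) * W k = W k * V k * (V k * W k) := by simp only [Matrix.mul_assoc]
        _ = W k * V k * W k * V k := by rw [hVW, ← Matrix.mul_assoc]
        _ = W k * V k := by rw [hWVW]
    calc D * W k * (W k * D) * ρk k * (D * W k * (W k * D))
        = D * W k * (W k * (D * ρk k * D) * W k) * W k * D := by simp only [Matrix.mul_assoc]
      _ = D * W k * (W k * V k * W k) * D := by
          rw [← hVV, hw]
          simp only [Matrix.mul_assoc]
      _ = D * W k * (W k * D) := by rw [hWVW, Matrix.mul_assoc]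
  obtain ⟨M, hM, hle⟩ := exists_measurement_of_family h f (decoder g f J)
    (posSemidef_one_sub_sum_decoder_gram hf hg hh hJJ)
  refine ⟨M, hM, le_trans ?_ hle⟩
  set c : ℝ := (√(2 ^ m))⁻¹ with hc
  have hcpos : 0 < c := by positivity
  have hc2 : 2 ^ m * (c * c) = 1 := by
    rw [hc, ← mul_inv, Real.mul_self_sqrt (by positivity)]
    exact mul_inv_cancel₀ (by positivity)
  have htrace : ∀ k, (S * S * (V k * V k)).trace.re = (ρk k).trace.re := fun k => by
    rw [hVV]
    congr 1
    calc (S * S * (D * ρk k * D)).trace = (S * (S * (D * ρk k)) * D).trace := by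
          simp only [Matrix.mul_assoc]
      _ = (S * (D * ρk k)).trace := by
          rw [hSDk, Matrix.trace_mul_comm, ← Matrix.mul_assoc, ← hSD.comm, Matrix.mul_assoc,
            hSDk]
      _ = _ := by rw [hSDk]
  have hineq : ∀ k, 3 * (ρk k).trace.re ≤ 2 * c * (S * S * S * V k).trace.re
      + 2 ^ m * (D * ρk k * D * (D * ρk k * D)).trace.re := fun k => by
    -- The factor `c = 2^{-m/2}` makes the inequality tight for a perfect key: if `ρ_k = 2^{-m}
    -- ρ_E`, then `V k = c S`.
    have hcS : ((c : ℂ) • S).PosSemidef := hSD.posSemidef.smul (by exact_mod_cast hcpos.le)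
    have h1 := three_trace_sq_le hcS (hV k)
    simp only [Matrix.smul_mul, Matrix.mul_smul, Matrix.trace_smul, smul_eq_mul,
      Complex.re_ofReal_mul, htrace] at h1
    rw [hVV] at h1
    have h2 := mul_le_mul_of_nonneg_left h1 (show (0 : ℝ) ≤ 2 ^ m by positivity)
    calc 3 * (ρk k).trace.re = 2 ^ m * (3 * (c * (c * (ρk k).trace.re))) := by
          linear_combination (-3 * (ρk k).trace.re) * hc2
      _ ≤ _ := h2
      _ = _ := by linear_combination (2 * c * (S * S * S * V k).trace.re) * hc2
  -- For a perfect key, `Y` is the mean over `e` of `phaseBlock f e * decoder g f J e`. As it does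
  -- not depend on `e`, the bound `‖Z‖² ≥ 2 Re⟨Z, Y⟩ - ‖Y‖²` can be summed using only the total over
  -- `e`.
  set Y : Matrix E E ℂ := (((√(2 ^ n))⁻¹ : ℝ) : ℂ) • (S * S) with hY
  have hYH : Yᴴ = Y := by
    simp [hY, hSD.posSemidef.1.eq]
  have hYY : (2 : ℝ) ^ n * (Y * Yᴴ).trace.re = (∑ a, ρ a).trace.re := by
    have h1 : ((2 : ℂ) ^ n)⁻¹ = (((2 : ℝ) ^ n)⁻¹ : ℝ) := by push_cast; rfl
    rw [hYH, hY, Matrix.smul_mul, Matrix.mul_smul, smul_smul, ofReal_inv_sqrt_mul_self,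
      hSD.pow_four, Matrix.trace_smul, smul_eq_mul, h1, Complex.re_ofReal_mul,
      mul_inv_cancel_left₀ (by positivity)]
  have hpoint : ∀ e, 2 * (phaseBlock f e * decoder g f J e * Yᴴ).trace.re - (Y * Yᴴ).trace.re
      ≤ ((phaseBlock f e * decoder g f J e) * (phaseBlock f e * decoder g f J e)ᴴ).trace.re := by
    intro e
    have := re_trace_mul_conjTranspose_nonneg (phaseBlock f e * decoder g f J e - Y)
    rw [re_trace_gram_sub] at this
    linarith
  refine le_trans ?_ (Finset.sum_le_sum fun e _ => hpoint e)
  have hsum : ∑ e, (phaseBlock f e * decoder g f J e * Yᴴ).trace.re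
      = c * ∑ k, (S * S * S * V k).trace.re := by
    have h1 : ∀ k, (ρk k * J k * (S * S)).trace = (S * S * S * V k).trace := fun k => by
      rw [hρJ, Matrix.trace_mul_comm]
      simp only [Matrix.mul_assoc]
    rw [← Complex.re_sum, ← Matrix.trace_sum, ← Matrix.sum_mul, sum_phaseBlock_mul_decoder hf,
      hYH, hY, Matrix.smul_mul, Matrix.mul_smul, smul_smul, ← Complex.ofReal_mul,
      Matrix.trace_smul, smul_eq_mul, Complex.re_ofReal_mul, Matrix.sum_mul, Matrix.trace_sum,
      Complex.re_sum]
    have h2 : √((2 : ℝ) ^ n) * (√(2 ^ m))⁻¹ * (√(2 ^ n))⁻¹ = c := by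
      rw [mul_right_comm, mul_inv_cancel₀ (by positivity), one_mul]
    rw [h2, Finset.sum_congr rfl fun k _ => congrArg Complex.re (h1 k)]
  have htot : ∑ k, (ρk k).trace.re = (∑ a, ρ a).trace.re := by
    rw [← Finset.sum_fiberwise Finset.univ g ρ, Matrix.trace_sum, Complex.re_sum]
  have hall := Finset.sum_le_sum fun k (_ : k ∈ Finset.univ) => hineq k
  rw [← Finset.mul_sum, Finset.sum_add_distrib, ← Finset.mul_sum, ← Finset.mul_sum, htot] at hall
  rw [Finset.sum_sub_distrib, ← Finset.mul_sum, hsum]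
  have hcard : ∑ _e : Bits n, (Y * Yᴴ).trace.re = (∑ a, ρ a).trace.re := by
    rw [← hYY]
    simp [ZMod.card]
  rw [hcard]
  linarith

lemma le_of_cqState_le {ρ : Bits n → Matrix E E ℂ} {σ : Matrix E E ℂ} {c : ℂ}
    (h : cqState ρ ≤ c • ((1 : Matrix (Bits n) (Bits n) ℂ) ⊗ₖ σ)) (a : Bits n) :
    (c • σ - ρ a).PosSemidef := by
  have := (Matrix.le_iff.1 h).submatrix fun ε : E => (a, ε)
  have h1 : c • σ - ρ a = (c • ((1 : Matrix (Bits n) (Bits n) ℂ) ⊗ₖ σ) - cqState ρ).submatrix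
      (fun ε => (a, ε)) fun ε => (a, ε) := by
    ext ε ε'
    simp [cqState_apply]
  rw [h1]
  exact this

/-- The averaged collision probability after hashing, relative to `ρ_E`. -/
lemma sum_collision_le {ρ : Bits n → Matrix E E ℂ} (hρ : ∀ a, (ρ a).PosSemidef)
    {S D : Matrix E E ℂ} (hSD : IsFourthRootPinv (∑ a, ρ a) S D)
    {p : G → ℝ} (hp : IsProbability p) {g : G → Bits n → Bits m} (hu : IsUniversal2 p g)
    {σ : Matrix E E ℂ} (hσ : σ.PosSemidef) (hσ1 : σ.trace = 1) {c : ℝ}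
    (hle : ∀ a, ((c : ℂ) • σ - ρ a).PosSemidef) (hc : 0 ≤ c) :
    ∑ i, p i * (2 ^ m * ∑ k, (D * (∑ a with g i a = k, ρ a) * D *
        (D * (∑ a with g i a = k, ρ a) * D)).trace.re)
      ≤ 2 ^ m * c + (∑ a, ρ a).trace.re := by
  set q : Bits n → Bits n → ℝ := fun a b => (D * ρ a * D * (D * ρ b * D)).trace.re with hq
  have hDpos : ∀ a, (D * ρ a * D).PosSemidef := fun a => by
    have := (hρ a).mul_mul_conjTranspose_same D
    rwa [hSD.isHermitian.eq] at this
  have hq0 : ∀ a b, 0 ≤ q a b := fun a b => re_trace_mul_nonneg (hDpos a) (hDpos b)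
  have hDρD : D * (∑ a, ρ a) * D = S * S := by
    rw [← hSD.pow_four]
    calc D * (S * S * (S * S)) * D = (D * S) * S * (S * (S * D)) := by
          simp only [Matrix.mul_assoc]
      _ = (S * D * S) * (S * D * S) := by 
          rw [← hSD.comm, Matrix.mul_assoc S D S, ← hSD.comm]
      _ = S * S := by rw [hSD.mul_mul_left]
  have hqsum : ∑ a, ∑ b, q a b = (∑ a, ρ a).trace.re := by
    have : ∑ a, ∑ b, q a b = (D * (∑ a, ρ a) * D * (D * (∑ a, ρ a) * D)).trace.re := by
      simp only [hq, Matrix.mul_sum, Matrix.sum_mul, Matrix.trace_sum, Complex.re_sum]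
      exact Finset.sum_comm
    rw [this, hDρD, hSD.pow_four]
  -- One factor `ρ a` is replaced by `c σ`; the remaining operators sum to the support projection `S
  -- D` of `ρ_E`, whose trace against `σ` is at most `1`.
  have hdiag : ∑ a, q a a ≤ c := by
    have h1 : ∀ a, q a a ≤ c * (D * (D * ρ a * D) * D * σ).trace.re := fun a => by
      have hpos : (D * (D * ρ a * D) * D).PosSemidef := by
        have := (hDpos a).mul_mul_conjTranspose_same D
        rwa [hSD.isHermitian.eq] at this
      have h2 := re_trace_mul_nonneg hpos (hle a)
      rw [Matrix.mul_sub, Matrix.trace_sub, Complex.sub_re, Matrix.mul_smul, Matrix.trace_smul,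
        smul_eq_mul, Complex.re_ofReal_mul] at h2
      have h3 : q a a = (D * (D * ρ a * D) * D * ρ a).trace.re := by
        simp only [hq]
        congr 1
        rw [← Matrix.mul_assoc, Matrix.trace_mul_comm]
        simp only [Matrix.mul_assoc]
      linarith
    have hproj : D * (D * (∑ a, ρ a) * D) * D = S * D := by
      rw [hDρD]
      calc D * (S * S) * D = (D * S) * (S * D) := by simp only [Matrix.mul_assoc]
        _ = S * D * S * D := by rw [← hSD.comm]; simp only [Matrix.mul_assoc]
        _ = S * D := by rw [hSD.mul_mul_left]
    have h4 : ∑ a, (D * (D * ρ a * D) * D * σ).trace.re = (S * D * σ).trace.re := by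
      rw [← hproj]
      simp only [Matrix.mul_sum, Matrix.sum_mul, Matrix.trace_sum, Complex.re_sum]
    have h5 : (S * D * σ).trace.re ≤ 1 := by
      have hH : (S * D)ᴴ = S * D := by
        rw [Matrix.conjTranspose_mul, hSD.isHermitian.eq, hSD.posSemidef.1.eq, hSD.comm]
      have hI : S * D * (S * D) = S * D := by
        rw [← Matrix.mul_assoc, hSD.mul_mul_left]
      have := re_trace_mul_nonneg (posSemidef_one_sub_of_idempotent hH hI) hσ
      rw [Matrix.sub_mul, Matrix.one_mul, Matrix.trace_sub, hσ1] at this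
      simpa using this
    calc ∑ a, q a a ≤ ∑ a, c * (D * (D * ρ a * D) * D * σ).trace.re :=
          Finset.sum_le_sum fun a _ => h1 a
      _ = c * (S * D * σ).trace.re := by rw [← Finset.mul_sum, h4]
      _ ≤ c := mul_le_of_le_one_right hc h5
  have hexp : ∀ i, ∑ k, (D * (∑ a with g i a = k, ρ a) * D *
        (D * (∑ a with g i a = k, ρ a) * D)).trace.re
      = ∑ a, ∑ b, if g i a = g i b then q a b else 0 := by
    intro i
    rw [← Finset.sum_fiberwise Finset.univ (g i)]
    refine Finset.sum_congr rfl fun k _ => ?_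
    simp only [Matrix.mul_sum, Matrix.sum_mul, Matrix.trace_sum, Complex.re_sum]
    rw [Finset.sum_comm]
    refine Finset.sum_congr rfl fun a ha => ?_
    rw [Finset.sum_filter]
    refine Finset.sum_congr rfl fun b _ => ?_
    rw [(Finset.mem_filter.1 ha).2]
    simp only [hq, eq_comm]
  calc _ = ∑ a, ∑ b, 2 ^ m * ((∑ i with g i a = g i b, p i) * q a b) := by
        simp only [hexp]
        simp only [Finset.mul_sum, Finset.sum_mul, Finset.sum_filter]
        rw [Finset.sum_comm]
        refine Finset.sum_congr rfl fun a _ => ?_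
        rw [Finset.sum_comm]
        refine Finset.sum_congr rfl fun b _ => Finset.sum_congr rfl fun i _ => ?_
        split_ifs
        · ring
        · simp
    -- Equal strings always collide, with weight `2^m`; for distinct strings universality cancels
    -- the `2^m`.
    _ ≤ ∑ a, ∑ b, ((if a = b then 2 ^ m * q a b else 0) + q a b) := by
        refine Finset.sum_le_sum fun a _ => Finset.sum_le_sum fun b _ => ?_
        split_ifs with hab
        · subst hab
          simp only [Finset.filter_true, hp.2, one_mul]
          linarith [hq0 a a]
        · have h1 := mul_le_mul_of_nonneg_right (hu a b hab) (hq0 a b)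
          have h2 := mul_le_mul_of_nonneg_left h1 (show (0 : ℝ) ≤ 2 ^ m by positivity)
          rw [mul_inv_cancel_left₀ (by positivity)] at h2
          linarith
    _ = 2 ^ m * ∑ a, q a a + (∑ a, ρ a).trace.re := by
        simp only [Finset.sum_add_distrib, hqsum, Finset.mul_sum]
        simp
    _ ≤ _ := by gcongr

/-- Each block is dominated by `ρ_E`, so the normalized `ρ_E` is an admissible `σ`. Nonemptiness is
what allows an upper bound on all admissible exponents to pass to the supremum. -/
lemma minEntropySet_nonempty {ρ : Bits n → Matrix E E ℂ} (hρ : IsSubnormalizedCQ ρ)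
    (hρ0 : cqState ρ ≠ 0) : (minEntropySet (cqState ρ)).Nonempty := by
  have hE : (∑ a, ρ a).PosSemidef := Matrix.posSemidef_sum _ fun a _ => hρ.1 a
  have htr := Complex.le_def.1 hE.trace_nonneg
  set t : ℝ := (∑ a, ρ a).trace.re with ht
  have htC : (∑ a, ρ a).trace = (t : ℂ) := Complex.ext rfl htr.2.symm
  have ht0 : 0 < t := by
    refine lt_of_le_of_ne htr.1 fun h0 => hρ0 ?_
    have h1 : ∑ a, (ρ a).trace = 0 := by
      rw [← Matrix.trace_sum, htC, ← h0]; simp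
    have h2 : ∀ a, ρ a = 0 := fun a => (hρ.1 a).trace_eq_zero_iff.1
      ((Finset.sum_eq_zero_iff_of_nonneg fun a _ => (hρ.1 a).trace_nonneg).1 h1 a
        (Finset.mem_univ a))
    simp [cqState, h2]
  refine ⟨-Real.logb 2 t, (t : ℂ)⁻¹ • ∑ a, ρ a, ?_, ?_, ?_⟩
  · exact hE.smul (by rw [← Complex.ofReal_inv]; exact_mod_cast (inv_pos.2 ht0).le)
  · rw [Matrix.trace_smul, htC, smul_eq_mul, inv_mul_cancel₀ (by exact_mod_cast ht0.ne')]
  · rw [neg_neg, Real.rpow_logb (by norm_num) (by norm_num) ht0, Matrix.kronecker_smul, smul_smul,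
      mul_inv_cancel₀ (by exact_mod_cast ht0.ne'), one_smul, Matrix.le_iff]
    have h1 : (1 : Matrix (Bits n) (Bits n) ℂ) ⊗ₖ (∑ a, ρ a) - cqState ρ
        = cqState fun a => ∑ b with b ≠ a, ρ b := by
      ext ⟨a, ε⟩ ⟨b, ε'⟩
      rw [Matrix.sub_apply, cqState_apply, cqState_apply, Matrix.kroneckerMap_apply,
        Matrix.one_apply]
      split_ifs with hab
      · rw [one_mul, ← Matrix.sub_apply, Finset.filter_ne', ← Finset.sum_erase_eq_sub (by simp)]
      · simp
    rw [h1]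
    refine Matrix.posSemidef_sum _ fun a _ => Matrix.PosSemidef.kronecker ?_
      (Matrix.posSemidef_sum _ fun b _ => hρ.1 b)
    have := Matrix.posSemidef_self_mul_conjTranspose (proj a : Matrix (Bits n) (Bits n) ℂ)
    simpa [proj] using this

end FailureBound

end PhaseEC

end

/-! ### The main theorem. -/

theorem mainTheorem2 {n m : ℕ} {E A' G : Type*} [Fintype E] [DecidableEq E]
    [Fintype A'] [DecidableEq A'] [Fintype G] [DecidableEq G]
    (ρ : PhaseEC.Bits n → Matrix E E ℂ) (hρ : PhaseEC.IsSubnormalizedCQ ρ)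
    (hρ0 : PhaseEC.cqState ρ ≠ 0)
    (Ψ : (PhaseEC.Bits n × E) × A' → ℂ) (hΨ : PhaseEC.IsPurification Ψ (PhaseEC.cqState ρ))
    (p : G → ℝ) (hp : PhaseEC.IsProbability p)
    (g : G → PhaseEC.Bits n →ₗ[ZMod 2] PhaseEC.Bits m)
    (hg : ∀ i, Function.Surjective (g i))
    (hu : PhaseEC.IsUniversal2 p (fun i => ⇑(g i)))
    (h : G → Matrix (Fin (n - m)) (Fin n) (ZMod 2))
    (hh : ∀ i, PhaseEC.IsCheckMatrix (g i) (h i)) :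
    (∀ M : G → PhaseEC.Bits (n - m) → PhaseEC.Bits n → Matrix A' A' ℂ,
      (∀ i, PhaseEC.IsAncillaMeasurement (M i)) →
        PhaseEC.secrecyDist p (fun i => ⇑(g i)) ρ ≤
          2 * √2 * √(PhaseEC.avgFailureProb p h M Ψ)) ∧
    ∃ M : G → PhaseEC.Bits (n - m) → PhaseEC.Bits n → Matrix A' A' ℂ,
      (∀ i, PhaseEC.IsAncillaMeasurement (M i)) ∧
      PhaseEC.secrecyDist p (fun i => ⇑(g i)) ρ ≤
        2 * √2 * √(PhaseEC.avgFailureProb p h M Ψ) ∧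
      2 * √2 * √(PhaseEC.avgFailureProb p h M Ψ) ≤
        2 * √2 * (2 : ℝ) ^ ((1 / 2 : ℝ) *
          ((m : ℝ) - PhaseEC.condMinEntropy (PhaseEC.cqState ρ))) ∧
      2 * √2 * (2 : ℝ) ^ ((1 / 2 : ℝ) *
          ((m : ℝ) - PhaseEC.condMinEntropy (PhaseEC.cqState ρ))) =
        (2 : ℝ) ^ ((1 / 2 : ℝ) *
          ((m : ℝ) - PhaseEC.condMinEntropy (PhaseEC.cqState ρ) + 3)) := by
  have hbound := fun M hM => PhaseEC.secrecyDist_le hρ hΨ hp hg hh M hM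
  refine ⟨hbound, ?_⟩
  have hEpos : (∑ a, ρ a).PosSemidef := Matrix.posSemidef_sum _ fun a _ => hρ.1 a
  obtain ⟨S, D, hSD⟩ := PhaseEC.exists_isFourthRootPinv hEpos
  choose M hM hMle using fun i =>
    PhaseEC.exists_measurement hρ.1 hΨ.block_mul hSD (hg i) (hh i)
  -- The measurements `M` are fixed before `r` and `σ`, so one choice serves all admissible
  -- exponents.
  have hfail : ∀ r ∈ PhaseEC.minEntropySet (PhaseEC.cqState ρ),
      PhaseEC.avgFailureProb p h M Ψ ≤ (2 : ℝ) ^ ((m : ℝ) - r) := by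
    rintro r ⟨σ, hσ, hσ1, hle⟩
    have hcol := PhaseEC.sum_collision_le hρ.1 hSD hp hu hσ hσ1 (PhaseEC.le_of_cqState_le hle)
      (by positivity)
    rw [sub_eq_add_neg, Real.rpow_add (by norm_num), Real.rpow_natCast]
    have h1 : PhaseEC.avgFailureProb p h M Ψ ≤ ∑ i, p i * (2 ^ m * ∑ k,
        (D * (∑ a with g i a = k, ρ a) * D * (D * (∑ a with g i a = k, ρ a) * D)).trace.re
          - (∑ a, ρ a).trace.re) := by
      refine Finset.sum_le_sum fun i _ => mul_le_mul_of_nonneg_left ?_ (hp.1 i)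
      rw [hΨ.phaseErrorProb_eq (hg i) (hh i) (hM i)]
      linarith [hMle i]
    simp only [mul_sub, Finset.sum_sub_distrib, ← Finset.sum_mul, hp.2, one_mul] at h1
    linarith
  refine ⟨M, hM, hbound M hM, ?_, ?_⟩
  · refine mul_le_mul_of_nonneg_left ?_ (by positivity)
    rw [mul_comm (1 / 2 : ℝ), Real.rpow_mul (by norm_num), ← Real.sqrt_eq_rpow]
    refine Real.sqrt_le_sqrt ?_
    -- A positive failure probability lets the bounds be read as `r ≤ m - log₂ P`, which passes to
    -- the supremum without its being attained.
    rcases le_or_gt (PhaseEC.avgFailureProb p h M Ψ) 0 with h0 | h0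
    · exact h0.trans (by positivity)
    · have hsup : PhaseEC.condMinEntropy (PhaseEC.cqState ρ)
          ≤ m - Real.logb 2 (PhaseEC.avgFailureProb p h M Ψ) := by
        refine csSup_le (PhaseEC.minEntropySet_nonempty hρ hρ0) fun r hr => ?_
        have := (Real.logb_le_iff_le_rpow (by norm_num) h0).2 (hfail r hr)
        linarith
      rw [← Real.logb_le_iff_le_rpow (by norm_num) h0]
      linarith
  · have h2 : 2 * √2 = (2 : ℝ) ^ ((1 / 2 : ℝ) * 3) := by
      rw [Real.sqrt_eq_rpow, ← Real.rpow_one_add' (by norm_num) (by norm_num)]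
      norm_num
    rw [h2, ← Real.rpow_add (by norm_num)]
    congr 1
    ring
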